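/- Let $k$ be an algebraically closed field of characteristic $p>0$, and let $X$ be a normal projective variety (integral scheme) over $k$ of dimension at least $2$ with $H^1(X,\mathcal O_X)=0$. Let $D$ be a connected (in particular non-empty) reduced effective Cartier divisor on $X$ and put $L=\mathcal O_X(D)$, so that $L^{a}=\mathcal O_X(aD)$ for every integer $a$. Assume that the restriction $L|_D$ has order exactly $p$ in $\mathrm{Pic}(D)$, and that $h^0(X,\mathcal O_X(mD))=1$ for every integer $m>0$. Let $M=L^{-p-1}$ or $M=L^{p-1}$. Then for every integral scheme $Y$ and every proper, surjective, generically finite morphism $\pi:Y\to X$ (that is, $\pi$ is finite over some non-empty open subset of $X$), the pullback map $$\pi^*: H^1(X,M)\longrightarrow H^1(Y,\pi^*M)$$ is non-zero. -/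

import Mathlib

universe u

open CategoryTheory CategoryTheory.Limits TopologicalSpace AlgebraicGeometry Opposite

noncomputable section

namespace NefLineBundles

/-! ### Varieties and morphisms -/

attribute [local instance] MvPolynomial.gradedAlgebra

/-- Projective space `ℙⁿ` over `k`, as `Proj k[x₀, …, xₙ]`. -/
def projectiveSpace (k : Type u) [Field k] (n : ℕ) : Scheme.{u} :=
  Proj (MvPolynomial.homogeneousSubmodule (Fin (n + 1)) k)

/-- The structure morphism of `ℙⁿ` over `k`. -/
def projectiveSpaceToSpec (k : Type u) [Field k] (n : ℕ) :
    projectiveSpace k n ⟶ Spec (CommRingCat.of k) :=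
  (Proj.toSpecZero (MvPolynomial.homogeneousSubmodule (Fin (n + 1)) k)) ≫
    Spec.map (CommRingCat.ofHom (algebraMap k _))

/-- A `k`-scheme is projective if it is a closed `k`-subscheme of some `ℙⁿ`. -/
def IsProjective {k : Type u} [Field k] {X : Scheme.{u}} (s : X ⟶ Spec (CommRingCat.of k)) : Prop :=
  ∃ (n : ℕ) (i : X ⟶ projectiveSpace k n),
    IsClosedImmersion i ∧ i ≫ projectiveSpaceToSpec k n = s

/-- A scheme is normal if all its local rings are integrally closed domains. -/
def IsNormal (X : Scheme.{u}) : Prop :=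
  ∀ x : X, IsDomain (X.presheaf.stalk x) ∧ IsIntegrallyClosed (X.presheaf.stalk x)

/-- A morphism is generically finite if it is finite over some nonempty open subset of the
target. -/
def IsGenericallyFinite {X Y : Scheme.{u}} (π : Y ⟶ X) : Prop :=
  ∃ U : X.Opens, (U : Set X).Nonempty ∧ IsFinite (π ∣_ U)

/-! ### Tensor products of sheaves of modules -/

/-- The structure sheaf as a sheaf of modules. -/
abbrev structureModule (X : Scheme.{u}) : X.Modules := SheafOfModules.unit X.ringCatSheaf

/-- The tensor product of two sheaves of modules: the sheafification of
`U ↦ M(U) ⊗ N(U)`. -/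
def tensor {X : Scheme.{u}} (M N : X.Modules) : X.Modules :=
  (PresheafOfModules.sheafification (𝟙 X.ringCatSheaf.obj)).obj
    (PresheafOfModules.Monoidal.tensorObj (R := X.presheaf) M.val N.val)

/-- The tensor powers `M^{⊗ n}`. -/
def tensorPow {X : Scheme.{u}} (M : X.Modules) : ℕ → X.Modules
  | 0 => structureModule X
  | n + 1 => tensor M (tensorPow M n)

/-- The isomorphism class of the line bundle `M` has order `n` in the Picard group: among the
tensor powers of `M`, exactly those whose exponent is divisible by `n` are trivial. -/
def HasPicOrder {X : Scheme.{u}} (M : X.Modules) (n : ℕ) : Prop :=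
  ∀ m : ℕ, Nonempty (tensorPow M m ≅ structureModule X) ↔ n ∣ m

/-! ### Cohomology -/

/-- The sheaf cohomology `Hⁿ(X, M)`. -/
abbrev coh (X : Scheme.{u}) (M : X.Modules) (n : ℕ) : Type u :=
  Sheaf.H ((SheafOfModules.toSheaf X.ringCatSheaf).obj M) n

/-- The dimension over `k` of `H⁰(X, M)`, for a scheme `X` over `k`. -/
def h0 {k : Type u} [Field k] {X : Scheme.{u}} (s : X ⟶ Spec (CommRingCat.of k))
    (M : X.Modules) : ℕ :=
  letI := Module.compHom Γ(M, ⊤) ((Scheme.ΓSpecIso (CommRingCat.of k)).inv ≫ s.appTop).hom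
  Module.finrank k Γ(M, ⊤)

/-- The inverse image functor `f⁻¹` on sheaves of abelian groups. -/
abbrev inverseImage {X Y : Scheme.{u}} (f : Y ⟶ X) :
    Sheaf (Opens.grothendieckTopology X) AddCommGrpCat.{u} ⥤
      Sheaf (Opens.grothendieckTopology Y) AddCommGrpCat.{u} :=
  (Opens.map f.base).sheafPullback AddCommGrpCat.{u}
    (Opens.grothendieckTopology X) (Opens.grothendieckTopology Y)

/-- The adjunction between `f⁻¹` and `f_*` for sheaves of abelian groups. -/
abbrev inverseImageAdj {X Y : Scheme.{u}} (f : Y ⟶ X) :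
    inverseImage f ⊣ (Opens.map f.base).sheafPushforwardContinuous AddCommGrpCat.{u}
      (Opens.grothendieckTopology X) (Opens.grothendieckTopology Y) :=
  (Opens.map f.base).sheafAdjunctionContinuous AddCommGrpCat.{u}
    (Opens.grothendieckTopology X) (Opens.grothendieckTopology Y)

instance {X Y : Scheme.{u}} (f : Y ⟶ X) : PreservesFiniteColimits (inverseImage f) :=
  haveI := (inverseImageAdj f).leftAdjoint_preservesColimits
  inferInstance

instance {X Y : Scheme.{u}} (f : Y ⟶ X) : PreservesFiniteLimits (inverseImage f) := by
  have : PreservesFiniteLimits ((Opens.map f.base).op.lan :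
      (_ ⥤ AddCommGrpCat.{u}) ⥤ (_ ⥤ AddCommGrpCat.{u})) := inferInstance
  exact Functor.sheafPullbackConstruction.preservesFiniteLimits (Opens.map f.base)
    AddCommGrpCat.{u} (Opens.grothendieckTopology X) (Opens.grothendieckTopology Y)

instance {X Y : Scheme.{u}} (f : Y ⟶ X) : (inverseImage f).Additive :=
  haveI := preservesBinaryBiproducts_of_preservesBinaryCoproducts (inverseImage f)
  Functor.additive_of_preservesBinaryBiproducts _

/-- The constant sheaf `ℤ` on `X`. -/
abbrev constZ (X : Scheme.{u}) : Sheaf (Opens.grothendieckTopology X) AddCommGrpCat.{u} :=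
  (constantSheaf (Opens.grothendieckTopology X) AddCommGrpCat.{u}).obj
    (AddCommGrpCat.of (ULift ℤ))

/-- The canonical map `ℤ_Y ⟶ f⁻¹ ℤ_X`, determined by the global section `f⁻¹(1)`. -/
def constZToInverseImage {X Y : Scheme.{u}} (f : Y ⟶ X) :
    constZ Y ⟶ (inverseImage f).obj (constZ X) :=
  ((constantSheafAdj (Opens.grothendieckTopology Y) AddCommGrpCat.{u}
      (isTerminalTop : IsTerminal (⊤ : Opens Y))).homEquiv _ _).symm
    (((constantSheafAdj (Opens.grothendieckTopology X) AddCommGrpCat.{u}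
      (isTerminalTop : IsTerminal (⊤ : Opens X))).homEquiv _ _)
        ((inverseImageAdj f).unit.app (constZ X)))

/-- The canonical map `f⁻¹ M ⟶ f^* M` of sheaves of abelian groups, adjoint to the unit
`M ⟶ f_* f^* M`. -/
def inverseImageToPullback {X Y : Scheme.{u}} (f : Y ⟶ X) (M : X.Modules) :
    (inverseImage f).obj ((SheafOfModules.toSheaf X.ringCatSheaf).obj M) ⟶
      (SheafOfModules.toSheaf Y.ringCatSheaf).obj ((Scheme.Modules.pullback f).obj M) :=
  ((inverseImageAdj f).homEquiv _ _).symm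
    ((SheafOfModules.toSheaf X.ringCatSheaf).map
      ((Scheme.Modules.pullbackPushforwardAdjunction f).unit.app M))

/-- The pullback map `Hⁿ(X, M) → Hⁿ(Y, f^* M)`: the composite
`Extⁿ(ℤ_X, M) → Extⁿ(f⁻¹ ℤ_X, f⁻¹ M) → Extⁿ(ℤ_Y, f⁻¹ M) → Extⁿ(ℤ_Y, f^* M)`. -/
def cohPullback {X Y : Scheme.{u}} (f : Y ⟶ X) (M : X.Modules) (n : ℕ) :
    coh X M n →+ coh Y ((Scheme.Modules.pullback f).obj M) n :=
  ((Abelian.Ext.mk₀ (inverseImageToPullback f M)).postcomp (constZ Y) (add_zero n)).comp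
    (((Abelian.Ext.mk₀ (constZToInverseImage f)).precomp _ (zero_add n)).comp
      ((inverseImage f).mapExtAddHom (constZ X)
        ((SheafOfModules.toSheaf X.ringCatSheaf).obj M) n))

/-! ### Effective Cartier divisors -/

/-- An effective Cartier divisor on `X`: an ideal sheaf that is locally generated by one
nonzerodivisor. -/
structure EffectiveCartierDivisor (X : Scheme.{u}) where
  /-- the ideal sheaf of the divisor -/
  ideal : X.IdealSheafData
  locally_principal : ∀ x : X, ∃ U : X.affineOpens, x ∈ U.1 ∧
    ∃ f : Γ(X, U), f ∈ nonZeroDivisors Γ(X, U) ∧ ideal.ideal U = Ideal.span {f}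

namespace EffectiveCartierDivisor

/-- The divisor, as a closed subscheme. -/
abbrev toScheme {X : Scheme.{u}} (D : EffectiveCartierDivisor X) : Scheme.{u} :=
  D.ideal.subscheme

/-- The inclusion of the divisor. -/
abbrev incl {X : Scheme.{u}} (D : EffectiveCartierDivisor X) : D.toScheme ⟶ X :=
  D.ideal.subschemeι

variable {X : Scheme.{u}} [IsIntegral X] (D : EffectiveCartierDivisor X) (a : ℤ)

/-- The stalk of `𝒪_X(aD)` at `x` inside the function field: all `c` such that `c fᵃ` lies in
the local ring at `x`, where `f` is a local equation of `D` near `x`. -/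
def fractions (x : X) : Submodule (X.presheaf.stalk x) X.functionField where
  carrier := { c | ∀ (U : X.affineOpens) (hx : x ∈ U.1) (f : Γ(X, U)),
    D.ideal.ideal U = Ideal.span {f} →
      c * (algebraMap (X.presheaf.stalk x) X.functionField
        (X.presheaf.germ U.1 x hx f)) ^ a ∈
          (algebraMap (X.presheaf.stalk x) X.functionField).range }
  zero_mem' U hx f _ := by rw [zero_mul]; exact zero_mem _
  add_mem' h₁ h₂ U hx f hf := by
    rw [add_mul]; exact add_mem (h₁ U hx f hf) (h₂ U hx f hf)
  smul_mem' r c h U hx f hf := by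
    rw [Algebra.smul_def, mul_assoc]; exact mul_mem ⟨r, rfl⟩ (h U hx f hf)

/-- The sections of `𝒪_X(aD)` over `U`: the sections `g` of the constant sheaf of rational
functions such that `g fᵃ` is regular on `U` for local equations `f` of `D`. -/
def sections (U : X.Opens) : AddSubgroup (U → X.functionField) where
  carrier := { g | IsLocallyConstant g ∧ ∀ x : U, g x ∈ D.fractions a x }
  zero_mem' := ⟨IsLocallyConstant.const 0, fun x => (D.fractions a x).zero_mem⟩
  add_mem' h₁ h₂ := ⟨h₁.1.add h₂.1, fun x => (D.fractions a x).add_mem (h₁.2 x) (h₂.2 x)⟩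
  neg_mem' h := ⟨h.1.neg, fun x => (D.fractions a x).neg_mem (h.2 x)⟩

/-- A regular function on `U`, as a section of the constant sheaf of rational functions. -/
def toRat (X : Scheme.{u}) [IsIntegral X] (U : X.Opens) : Γ(X, U) →+* (U → X.functionField) :=
  RingHom.pi fun x : U =>
    (algebraMap (X.presheaf.stalk x.1) X.functionField).comp (X.presheaf.germ U x.1 x.2).hom

lemma isLocallyConstant_toRat (U : X.Opens) (r : Γ(X, U)) :
    IsLocallyConstant (toRat X U r) := by
  refine IsLocallyConstant.of_constant _ fun x y => ?_
  have : Nonempty U := ⟨x⟩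
  exact (Scheme.algebraMap_germ_eq_germToFunctionField X x.2 r).trans
    (Scheme.algebraMap_germ_eq_germToFunctionField X y.2 r).symm

instance (U : X.Opens) : SMul Γ(X, U) (D.sections a U) where
  smul r g := ⟨toRat X U r * g.1, (isLocallyConstant_toRat U r).mul g.2.1, fun x => by
    have := (D.fractions a x).smul_mem (X.presheaf.germ U x.1 x.2 r) (g.2.2 x)
    rwa [Algebra.smul_def] at this⟩

instance (U : X.Opens) : Module Γ(X, U) (D.sections a U) where
  one_smul g := Subtype.ext (by change toRat X U 1 * g.1 = g.1; rw [map_one, one_mul])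
  mul_smul r s g := Subtype.ext (by
    change toRat X U (r * s) * g.1 = toRat X U r * (toRat X U s * g.1)
    rw [map_mul, mul_assoc])
  smul_zero r := Subtype.ext (mul_zero (toRat X U r))
  smul_add r g h := Subtype.ext (mul_add (toRat X U r) g.1 h.1)
  add_smul r s g := Subtype.ext (by
    change toRat X U (r + s) * g.1 = toRat X U r * g.1 + toRat X U s * g.1
    rw [map_add, add_mul])
  zero_smul g := Subtype.ext (by change toRat X U 0 * g.1 = 0; rw [map_zero, zero_mul])

/-- Restriction of sections of `𝒪_X(aD)`. -/
def restrict {U V : X.Opens} (i : V ≤ U) : D.sections a U →+ D.sections a V where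
  toFun g := ⟨fun x => g.1 ⟨x.1, i x.2⟩,
    g.2.1.comp_continuous (continuous_inclusion i), fun x => g.2.2 ⟨x.1, i x.2⟩⟩
  map_zero' := rfl
  map_add' _ _ := rfl

/-- The presheaf of abelian groups underlying `𝒪_X(aD)`. -/
def presheaf : TopCat.Presheaf AddCommGrpCat.{u} X where
  obj U := AddCommGrpCat.of (D.sections a U.unop)
  map i := AddCommGrpCat.ofHom (D.restrict a i.unop.le)

/-- Membership in `𝒪_X(aD)` as a local condition on functions with values in the function
field. -/
def localPredicate : TopCat.LocalPredicate (fun _ : X => (X.functionField : Type u)) where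
  pred {U} g := g ∈ D.sections a U
  res {U V} i g h := (D.restrict a i.le ⟨g, h⟩).2
  locality {U} g h := by
    refine ⟨(IsLocallyConstant.iff_exists_open g).2 fun x => ?_, fun x => ?_⟩
    · obtain ⟨V, hxV, i, hV⟩ := h x
      obtain ⟨W, hW, hxW, hc⟩ := (IsLocallyConstant.iff_exists_open _).1 hV.1 ⟨x.1, hxV⟩
      obtain ⟨W', hW', rfl⟩ := isOpen_induced_iff.1 hW
      refine ⟨Subtype.val ⁻¹' (W' ∩ V), (hW'.inter V.isOpen).preimage continuous_subtype_val,
        ⟨hxW, hxV⟩, fun y hy => ?_⟩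
      exact hc ⟨y.1, hy.2⟩ hy.1
    · obtain ⟨V, hxV, i, hV⟩ := h x
      exact hV.2 ⟨x.1, hxV⟩

lemma isSheaf_presheaf : (D.presheaf a).IsSheaf :=
  (TopCat.Presheaf.isSheaf_iff_isSheaf_comp (forget AddCommGrpCat.{u}) _).mpr
    (TopCat.Presheaf.isSheaf_of_iso
      (NatIso.ofComponents (fun _ => Iso.refl _) :
        TopCat.subpresheafToTypes (D.localPredicate a).toPrelocalPredicate ≅
          D.presheaf a ⋙ forget AddCommGrpCat.{u})
      (TopCat.subpresheafToTypes.isSheaf (D.localPredicate a)))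

instance (U : (Opens X)ᵒᵖ) : Module (X.ringCatSheaf.obj.obj U) ((D.presheaf a).obj U) :=
  inferInstanceAs (Module Γ(X, U.unop) (D.sections a U.unop))

/-- The sheaf of modules `𝒪_X(aD)`, for an effective Cartier divisor `D` on an integral scheme
and an integer `a`, as a subsheaf of the constant sheaf of rational functions. This is the `a`-th
power of the line bundle `𝒪_X(D)`. -/
def sheaf : X.Modules where
  val := PresheafOfModules.ofPresheaf (R := X.ringCatSheaf.obj) (D.presheaf a) (by
    intro U V i r g
    refine Subtype.ext (funext fun x => ?_)
    refine congrArg₂ (· * ·) (congrArg (algebraMap (X.presheaf.stalk x.1) X.functionField) ?_) rfl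
    exact (X.presheaf.germ_res_apply i.unop x.1 x.2 r).symm)
  isSheaf := D.isSheaf_presheaf a

end EffectiveCartierDivisor

end NefLineBundles
end

open NefLineBundles

/-! A trivialization of $L|_D^{\otimes p}$ gives nowhere vanishing sections of $\mathcal O_X(aD)|_D$
for $a=\pm p$. The sequence $0\to\mathcal O_X((a-1)D)\to\mathcal O_X(aD)\to\mathcal O_X(aD)|_D\to0$
sends them to classes in $H^1(X,L^{-p-1})$ and $H^1(X,L^{p-1})$, and these classes survive on $Y$.
If the pullback map were zero, the section would extend, over $\pi^{-1}(D)$, to a global section $g$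
on $Y$ of the pullback of $\mathcal O_X(aD)$, where $g$ is a rational function on $Y$.

For $a=-p$, $g$ is a regular function vanishing on the non-empty set $\pi^{-1}(D)$. Global functions
on $Y$ form a field, so $g=0$. But $g/f^p$, with $f$ a local equation of $D$, is a unit along
$\pi^{-1}(D)$ (`cohPullback_neg_ne_zero`).

For $a=p$, $g$ has a pole of exact order $p$ along $\pi^{-1}(D)$. Let $N$ be the norm of $g$ from
$K(X)(g)$ to $K(X)$, and $m$ the degree. As $gf^p$ is integral over the local rings of the normal
scheme $X$, $Nf^{pm}$ is regular everywhere. The same argument for $(gf^p)^{-1}$ makes $Nf^{pm}$ a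
unit at a point of $D$. So $N$ is a section of $\mathcal O_X(pmD)$ with a genuine pole along $D$,
against $h^0=1$ (`cohPullback_sub_one_ne_zero`).

On the cohomological side, the sequence used is $0\to\mathcal O_X(aD)\to K\to K/\mathcal
O_X(aD)\to0$ with $K$ the constant sheaf of rational functions. A class is then given by a family of
rational functions `b x` whose local differences lie in $\mathcal O_X(aD)$, and its vanishing on $Y$
yields one rational function $g$ with $g-\pi^*b$ in the pulled back sheaf
(`exists_rational_of_cohPullback_eq_zero`). The family comes from lifting the trivialization locally
to $X$ (`exists_local_lifts`). -/

noncomputable section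

namespace NefLineBundles

/-! ### Vanishing of pullback maps on `Ext¹` -/

section Ext

variable {𝒜 ℬ : Type*} [Category* 𝒜] [Category* ℬ] [Abelian 𝒜] [Abelian ℬ]
  [HasExt.{u} 𝒜] [HasExt.{u} ℬ] {F : 𝒜 ⥤ ℬ} [F.Additive] [PreservesFiniteLimits F]
  [PreservesFiniteColimits F] {G : ℬ ⥤ 𝒜}

/-- If the map `Ext¹(Z, A) → Ext¹(Z', P)` given by an exact functor `F` and by morphisms
`Z' ⟶ F(Z)` and `F(A) ⟶ P` is zero, then a morphism from `Z` to a quotient of an extension of `A`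
lifts, after applying `F`, to any extension compatible with the given one. -/
lemma exists_lift_of_mapExt_eq_zero (adj : F ⊣ G) {Z A B C : 𝒜} {Z' P A' B' C' : ℬ}
    (z : Z' ⟶ F.obj Z) (a : F.obj A ⟶ P) (ψ : P ⟶ A')
    {i : A ⟶ B} {q : B ⟶ C} {w : i ≫ q = 0} (hS : (ShortComplex.mk i q w).ShortExact)
    {i' : A' ⟶ B'} {q' : B' ⟶ C'} {w' : i' ≫ q' = 0} (hS' : (ShortComplex.mk i' q' w').ShortExact)
    (t₁ : A ⟶ G.obj A') (t₂ : B ⟶ G.obj B') (t₃ : C ⟶ G.obj C')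
    (h₀ : a ≫ ψ = (adj.homEquiv _ _).symm t₁)
    (h₁ : i ≫ t₂ = t₁ ≫ G.map i') (h₂ : q ≫ t₃ = t₂ ≫ G.map q')
    (h : ((Abelian.Ext.mk₀ a).postcomp Z' (add_zero 1)).comp
      (((Abelian.Ext.mk₀ z).precomp _ (zero_add 1)).comp (F.mapExtAddHom Z A 1)) = 0)
    (c : Z ⟶ C) :
    ∃ b : Z' ⟶ B', b ≫ q' = z ≫ F.map c ≫ (adj.homEquiv _ _).symm t₃ := by
  -- The adjoint transposes of `t₂` and `t₃`, with `a ≫ ψ`, map the image under `F` of the first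
  -- sequence to the second. Naturality of extension classes then compares the two classes.
  let τ : (ShortComplex.mk i q w).map F ⟶ ShortComplex.mk i' q' w' :=
    { τ₁ := a ≫ ψ
      τ₂ := (adj.homEquiv _ _).symm t₂
      τ₃ := (adj.homEquiv _ _).symm t₃
      comm₁₂ := by
        change (a ≫ ψ) ≫ i' = F.map i ≫ _
        rw [h₀, ← Adjunction.homEquiv_naturality_right_symm,
          ← Adjunction.homEquiv_naturality_left_symm, h₁]
      comm₂₃ := by
        change _ ≫ q' = F.map q ≫ _
        rw [← Adjunction.homEquiv_naturality_right_symm,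
          ← Adjunction.homEquiv_naturality_left_symm, h₂] }
  obtain ⟨e, he⟩ : ∃ e : Abelian.Ext.{u} C A 1, e = hS.extClass := ⟨_, rfl⟩
  obtain ⟨e', he'⟩ : ∃ e' : Abelian.Ext.{u} C' A' 1, e' = hS'.extClass := ⟨_, rfl⟩
  have nat : (e.mapExactFunctor F).comp (Abelian.Ext.mk₀ (a ≫ ψ)) (add_zero 1) =
      (Abelian.Ext.mk₀ ((adj.homEquiv _ _).symm t₃)).comp e' (zero_add 1) := by
    rw [he, he']
    exact (congrArg (fun e => Abelian.Ext.comp e (Abelian.Ext.mk₀ (a ≫ ψ)) (add_zero 1))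
      (Abelian.Ext.mapExactFunctor_extClass F hS)).trans
      (ShortComplex.ShortExact.extClass_naturality (hS.map_of_exact F) hS' τ)
  -- This is the obstruction to lifting along `q'`. By `nat` it is the image under `ψ` of the
  -- pullback of the class `c · e` in `Ext¹(Z, A)`, which `h` kills.
  have key : (Abelian.Ext.mk₀ (z ≫ F.map c ≫ (adj.homEquiv _ _).symm t₃)).comp
      e' (zero_add 1) = 0 := by
    have h0 : (((Abelian.Ext.mk₀ z).comp (((Abelian.Ext.mk₀ c).comp e
        (zero_add 1)).mapExactFunctor F) (zero_add 1)).comp (Abelian.Ext.mk₀ a)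
          (add_zero 1)).comp (Abelian.Ext.mk₀ ψ) (add_zero 1) = 0 :=
      (congrArg (fun e => Abelian.Ext.comp e (Abelian.Ext.mk₀ ψ) (add_zero 1))
        (DFunLike.congr_fun h ((Abelian.Ext.mk₀ c).comp e (zero_add 1)))).trans
          (Abelian.Ext.zero_comp ..)
    rw [Abelian.Ext.comp_assoc_of_third_deg_zero, Abelian.Ext.mk₀_comp_mk₀,
      Abelian.Ext.comp_assoc_of_third_deg_zero, Abelian.Ext.mapExactFunctor_comp,
      Abelian.Ext.mapExactFunctor_mk₀, Abelian.Ext.comp_assoc_of_third_deg_zero, nat] at h0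
    rw [← h0, ← Abelian.Ext.mk₀_comp_mk₀, ← Abelian.Ext.mk₀_comp_mk₀,
      Abelian.Ext.comp_assoc_of_second_deg_zero, Abelian.Ext.comp_assoc_of_second_deg_zero]
  rw [he'] at key
  obtain ⟨x₂, hx₂⟩ := Abelian.Ext.covariant_sequence_exact₃ _ hS' _ (zero_add 1) key
  obtain ⟨x, rfl⟩ := (Abelian.Ext.mk₀_bijective _ _).2 x₂
  rw [Abelian.Ext.mk₀_comp_mk₀] at hx₂
  exact ⟨x, (Abelian.Ext.mk₀_bijective _ _).1 hx₂⟩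

end Ext

/-! ### Global sections as morphisms from the constant sheaf -/

/-- The pushforward of sheaves of abelian groups along a morphism of schemes. -/
abbrev directImage {X Y : Scheme.{u}} (f : Y ⟶ X) :
    Sheaf (Opens.grothendieckTopology Y) AddCommGrpCat.{u} ⥤
      Sheaf (Opens.grothendieckTopology X) AddCommGrpCat.{u} :=
  (Opens.map f.base).sheafPushforwardContinuous AddCommGrpCat.{u}
    (Opens.grothendieckTopology X) (Opens.grothendieckTopology Y)

/-- The constant sheaf `ℤ` corepresents global sections. -/
abbrev constZAdj (X : Scheme.{u}) :=
  constantSheafAdj (Opens.grothendieckTopology X) AddCommGrpCat.{u}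
    (isTerminalTop : IsTerminal (⊤ : Opens X))

/-- The morphism `ℤ_X ⟶ F` given by a global section of `F`. -/
def ofSection {X : Scheme.{u}} {F : Sheaf (Opens.grothendieckTopology X) AddCommGrpCat.{u}}
    (c : F.obj.obj (op ⊤)) : constZ X ⟶ F :=
  ((constZAdj X).homEquiv _ _).symm
    (AddCommGrpCat.ofHom ((zmultiplesHom _ c).comp AddEquiv.ulift.toAddMonoidHom))

/-- The global section of `F` given by a morphism `ℤ_X ⟶ F`. -/
def toSection {X : Scheme.{u}} {F : Sheaf (Opens.grothendieckTopology X) AddCommGrpCat.{u}}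
    (c : constZ X ⟶ F) : F.obj.obj (op ⊤) :=
  (((constZAdj X).homEquiv _ _) c).hom (ULift.up (1 : ℤ))

lemma toSection_ofSection {X : Scheme.{u}}
    {F : Sheaf (Opens.grothendieckTopology X) AddCommGrpCat.{u}} (c : F.obj.obj (op ⊤)) :
    toSection (ofSection c) = c := by
  unfold toSection ofSection
  rw [Equiv.apply_symm_apply]
  exact one_zsmul c

lemma toSection_comp {X : Scheme.{u}}
    {F G : Sheaf (Opens.grothendieckTopology X) AddCommGrpCat.{u}} (c : constZ X ⟶ F)
    (φ : F ⟶ G) : toSection (c ≫ φ) = φ.hom.app (op ⊤) (toSection c) := by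
  unfold toSection
  rw [Adjunction.homEquiv_naturality_right]
  rfl

lemma directImage_map_app_top {X Y : Scheme.{u}} (f : Y ⟶ X)
    {P G : Sheaf (Opens.grothendieckTopology Y) AddCommGrpCat.{u}} (w : P ⟶ G)
    (s : P.obj.obj (op ⊤)) :
    ((directImage f).map w).hom.app (op ⊤) s = w.hom.app (op ⊤) s :=
  rfl

lemma toSection_homEquiv_symm {X : Scheme.{u}}
    {F : Sheaf (Opens.grothendieckTopology X) AddCommGrpCat.{u}}
    (m : AddCommGrpCat.of (ULift.{u} ℤ) ⟶ F.obj.obj (op ⊤)) :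
    toSection (((constZAdj X).homEquiv _ F).symm m) = m.hom (ULift.up (1 : ℤ)) := by
  unfold toSection
  rw [Equiv.apply_symm_apply]

lemma toSection_constZToInverseImage' {X Y : Scheme.{u}} (f : Y ⟶ X) :
    toSection (constZToInverseImage f) = toSection ((inverseImageAdj f).unit.app (constZ X)) := by
  unfold constZToInverseImage
  exact toSection_homEquiv_symm _

/-- Since `constZToInverseImage f` is the pullback of the section 1, a lift found in the `Ext`
formalism translates back into an equality of global sections. -/
lemma toSection_constZToInverseImage {X Y : Scheme.{u}} (f : Y ⟶ X)
    {F : Sheaf (Opens.grothendieckTopology X) AddCommGrpCat.{u}}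
    {G : Sheaf (Opens.grothendieckTopology Y) AddCommGrpCat.{u}}
    (c : constZ X ⟶ F) (t : F ⟶ (directImage f).obj G) :
    toSection (constZToInverseImage f ≫ (inverseImage f).map c ≫
      ((inverseImageAdj f).homEquiv _ _).symm t) = t.hom.app (op ⊤) (toSection c) := by
  have h : c ≫ t = (inverseImageAdj f).unit.app _ ≫
      (directImage f).map (((inverseImageAdj f).homEquiv _ _).symm (c ≫ t)) :=
    ((Equiv.apply_symm_apply _ _).symm.trans (Adjunction.homEquiv_unit ..))
  rw [← Adjunction.homEquiv_naturality_left_symm]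
  generalize ((inverseImageAdj f).homEquiv _ _).symm (c ≫ t) = w at h ⊢
  rw [← toSection_comp, h, toSection_comp, toSection_comp]
  exact (congrArg _ (toSection_constZToInverseImage' f)).trans
    (directImage_map_app_top f w _).symm

lemma inverseImageToPullback_comp {X Y : Scheme.{u}} (f : Y ⟶ X) (M : X.Modules)
    (N : Y.Modules) (ψ : (Scheme.Modules.pullback f).obj M ⟶ N) :
    inverseImageToPullback f M ≫ (SheafOfModules.toSheaf Y.ringCatSheaf).map ψ =
      ((inverseImageAdj f).homEquiv _ _).symm
        ((SheafOfModules.toSheaf X.ringCatSheaf).map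
          ((Scheme.Modules.pullbackPushforwardAdjunction f).unit.app M ≫
            (Scheme.Modules.pushforward f).map ψ)) := by
  refine ((inverseImageAdj f).homEquiv_naturality_right_symm _ _).symm.trans ?_
  refine congrArg _ ?_
  rfl

/-- If pulling back `H¹(X, M)` along `f` is zero, then every global section of a quotient of an
extension of `M` lifts after pullback to a global section of any compatible extension on `Y`. -/
lemma exists_lift_of_cohPullback_eq_zero {X Y : Scheme.{u}} (f : Y ⟶ X) (M : X.Modules)
    (N : Y.Modules) (t₁ : M ⟶ (Scheme.Modules.pushforward f).obj N)
    {B C : Sheaf (Opens.grothendieckTopology X) AddCommGrpCat.{u}}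
    {B' C' : Sheaf (Opens.grothendieckTopology Y) AddCommGrpCat.{u}}
    {i : (SheafOfModules.toSheaf X.ringCatSheaf).obj M ⟶ B} {q : B ⟶ C} {w : i ≫ q = 0}
    (hS : (ShortComplex.mk i q w).ShortExact)
    {i' : (SheafOfModules.toSheaf Y.ringCatSheaf).obj N ⟶ B'} {q' : B' ⟶ C'} {w' : i' ≫ q' = 0}
    (hS' : (ShortComplex.mk i' q' w').ShortExact)
    (t₂ : B ⟶ (directImage f).obj B') (t₃ : C ⟶ (directImage f).obj C')
    (h₁ : i ≫ t₂ = (SheafOfModules.toSheaf X.ringCatSheaf).map t₁ ≫ (directImage f).map i')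
    (h₂ : q ≫ t₃ = t₂ ≫ (directImage f).map q')
    (h : cohPullback f M 1 = 0) (c : C.obj.obj (op ⊤)) :
    ∃ b : B'.obj.obj (op ⊤), q'.hom.app (op ⊤) b = t₃.hom.app (op ⊤) c := by
  -- By adjunction `t₁` comes from a map `ψ` out of the pullback of `M`. Vanishing in the cohomology
  -- of that pullback passes to `N` along `ψ`, so the two need not be identified.
  obtain ⟨ψ, rfl⟩ : ∃ ψ, t₁ = (Scheme.Modules.pullbackPushforwardAdjunction f).unit.app M ≫
      (Scheme.Modules.pushforward f).map ψ :=
    ⟨((Scheme.Modules.pullbackPushforwardAdjunction f).homEquiv _ _).symm t₁,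
      ((Equiv.apply_symm_apply _ _).symm.trans (Adjunction.homEquiv_unit ..))⟩
  obtain ⟨b, hb⟩ := exists_lift_of_mapExt_eq_zero (inverseImageAdj f) (constZToInverseImage f)
    (inverseImageToPullback f M) ((SheafOfModules.toSheaf Y.ringCatSheaf).map ψ) hS hS'
    _ t₂ t₃ (inverseImageToPullback_comp f M N ψ) h₁ h₂ h (ofSection c)
  refine ⟨toSection b, ?_⟩
  rw [← toSection_comp, hb, toSection_constZToInverseImage, toSection_ofSection]

/-! ### Rational functions modulo a subsheaf -/

/-- A criterion for a sequence of sheaves of abelian groups to be short exact, in terms of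
sections. -/
lemma shortExact_of_sections {X : Scheme.{u}}
    {A B C : Sheaf (Opens.grothendieckTopology X) AddCommGrpCat.{u}}
    {i : A ⟶ B} {q : B ⟶ C} (w : i ≫ q = 0)
    (hi : ∀ U : (Opens X)ᵒᵖ, Function.Injective (i.hom.app U))
    (hiq : ∀ (U : (Opens X)ᵒᵖ) (b : B.obj.obj U), q.hom.app U b = 0 → ∃ a, i.hom.app U a = b)
    (hq : ∀ (U : Opens X) (c : C.obj.obj (op U)), ∀ x ∈ U, ∃ (V : Opens X) (h : V ≤ U),
      (∃ b, q.hom.app (op V) b = C.obj.map (homOfLE h).op c) ∧ x ∈ V) :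
    (ShortComplex.mk i q w).ShortExact := by
  have hmono : Mono i := Sheaf.mono_of_injective i hi
  have hepi : Epi q := by
    rw [← Sheaf.isLocallySurjective_iff_epi']
    exact (TopCat.Presheaf.isLocallySurjective_iff (X := X.carrier) q.hom).2 hq
  refine ShortComplex.ShortExact.mk (ShortComplex.exact_of_f_is_kernel _ ?_)
  -- Preimages under `i` exist on every open set. Injectivity makes the chosen ones additive and
  -- compatible with restriction.
  refine KernelFork.IsLimit.ofι' i w fun {Z} k hk => ?_
  have hex : ∀ (U : (Opens X)ᵒᵖ) (z : Z.obj.obj U), ∃ a, i.hom.app U a = k.hom.app U z := by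
    intro U z
    refine hiq U _ ?_
    have := congrArg (fun m : Z ⟶ C => m.hom.app U z) hk
    exact this
  choose l hl using hex
  refine ⟨⟨{ app := fun U => AddCommGrpCat.ofHom
               { toFun := l U
                 map_zero' := hi U (by rw [hl, map_zero, map_zero])
                 map_add' := fun x y => hi U (by rw [hl, map_add, map_add, hl, hl]) }
             naturality := ?_ }⟩, ?_⟩
  · intro U V f
    ext z
    apply hi V
    change i.hom.app V (l V (Z.obj.map f z)) = i.hom.app V (A.obj.map f (l U z))
    rw [hl, NatTrans.naturality_apply, NatTrans.naturality_apply, hl]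
  · ext U z
    exact hl U z

section LocSheaf

variable {X : Scheme.{u}} {K : Type u} [AddCommGroup K] {Q : X → Type u}
  [∀ x, AddCommGroup (Q x)] (κ : ∀ x, K →+ Q x)

/-- Families in the groups `Q x` that are locally the image of one element of `K`. -/
def locSections (U : X.Opens) : AddSubgroup (∀ x : U, Q x) where
  carrier := { q | ∀ x : U, ∃ V : X.Opens, x.1 ∈ V ∧ ∃ k : K, ∀ y : U, y.1 ∈ V → q y = κ y k }
  zero_mem' x := ⟨⊤, trivial, 0, fun y _ => (map_zero _).symm⟩
  add_mem' := by
    intro q r hq hr x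
    obtain ⟨V, hV, k, hk⟩ := hq x
    obtain ⟨W, hW, l, hl⟩ := hr x
    exact ⟨V ⊓ W, ⟨hV, hW⟩, k + l, fun y hy => by
      rw [map_add, ← hk y hy.1, ← hl y hy.2]; rfl⟩
  neg_mem' := by
    intro q hq x
    obtain ⟨V, hV, k, hk⟩ := hq x
    exact ⟨V, hV, -k, fun y hy => by rw [map_neg, ← hk y hy]; rfl⟩

/-- Restriction of locally constant families. -/
def locRestrict {U V : X.Opens} (i : V ≤ U) : locSections κ U →+ locSections κ V where
  toFun q := ⟨fun x => q.1 ⟨x.1, i x.2⟩, fun x => by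
    obtain ⟨W, hW, k, hk⟩ := q.2 ⟨x.1, i x.2⟩
    exact ⟨W, hW, k, fun y hy => hk ⟨y.1, i y.2⟩ hy⟩⟩
  map_zero' := rfl
  map_add' _ _ := rfl

/-- The presheaf of families that are locally the image of one element of `K`. -/
def locPresheaf : TopCat.Presheaf AddCommGrpCat.{u} X where
  obj U := AddCommGrpCat.of (locSections κ U.unop)
  map i := AddCommGrpCat.ofHom (locRestrict κ i.unop.le)

/-- Being locally the image of one element of `K` is a local condition. -/
def locPredicate : TopCat.LocalPredicate Q where
  pred {U} q := q ∈ locSections κ U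
  res {U V} i q h := (locRestrict κ i.le ⟨q, h⟩).2
  locality {U} q h x := by
    obtain ⟨V, hxV, i, hV⟩ := h x
    obtain ⟨W, hW, k, hk⟩ := hV ⟨x.1, hxV⟩
    exact ⟨W ⊓ V, ⟨hW, hxV⟩, k, fun y hy => hk ⟨y.1, hy.2⟩ hy.1⟩

/-- The sheaf of families in the groups `Q x` that are locally the image of one element of `K`. -/
def locSheaf : Sheaf (Opens.grothendieckTopology X) AddCommGrpCat.{u} where
  obj := locPresheaf κ
  property :=
    (TopCat.Presheaf.isSheaf_iff_isSheaf_comp (forget AddCommGrpCat.{u}) _).mpr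
      (TopCat.Presheaf.isSheaf_of_iso
        (NatIso.ofComponents (fun _ => Iso.refl _) :
          TopCat.subpresheafToTypes (locPredicate κ).toPrelocalPredicate ≅
            locPresheaf κ ⋙ forget AddCommGrpCat.{u})
        (TopCat.subpresheafToTypes.isSheaf (locPredicate κ)))

variable {Q' : X → Type u} [∀ x, AddCommGroup (Q' x)] {κ' : ∀ x, K →+ Q' x}

/-- The map of sheaves of locally constant families induced by maps `Q x → Q' x` under `K`. -/
def locSheafMap (m : ∀ x, Q x →+ Q' x) (hm : ∀ x k, m x (κ x k) = κ' x k) :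
    locSheaf κ ⟶ locSheaf κ' :=
  ⟨{ app := fun U => AddCommGrpCat.ofHom
      { toFun := fun q => ⟨fun x => m x (q.1 x), fun x => by
          obtain ⟨V, hV, k, hk⟩ := q.2 x
          exact ⟨V, hV, k, fun y hy => (congrArg (m y) (hk y hy)).trans (hm _ _)⟩⟩
        map_zero' := Subtype.ext (funext fun x => map_zero _)
        map_add' := fun _ _ => Subtype.ext (funext fun x => map_add _ _ _) } }⟩

variable {Y : Scheme.{u}} {L : Type u} [AddCommGroup L] {R : Y → Type u}
  [∀ y, AddCommGroup (R y)] {ρ : ∀ y, L →+ R y}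

/-- The map from the sheaf of locally constant families on `X` to the pushforward of the one
on `Y`. -/
def locSheafPush (f : Y ⟶ X) (φ : K →+ L) (m : ∀ y, Q (f y) →+ R y)
    (hm : ∀ y k, m y (κ (f y) k) = ρ y (φ k)) :
    locSheaf κ ⟶ (directImage f).obj (locSheaf ρ) :=
  ⟨{ app := fun U => AddCommGrpCat.ofHom
      (show locSections κ U.unop →+ locSections ρ (f ⁻¹ᵁ U.unop) from
      { toFun := fun q => ⟨fun y => m y (q.1 ⟨f y, y.2⟩), fun y => by
          obtain ⟨V, hV, k, hk⟩ := q.2 ⟨f y, y.2⟩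
          exact ⟨f ⁻¹ᵁ V, hV, φ k, fun z hz =>
            (congrArg (m z) (hk ⟨f z, z.2⟩ hz)).trans (hm _ _)⟩⟩
        map_zero' := Subtype.ext (funext fun x => map_zero _)
        map_add' := fun _ _ => Subtype.ext (funext fun x => map_add _ _ _) }) }⟩

end LocSheaf

section RatSheaf

open EffectiveCartierDivisor

variable {X : Scheme.{u}} [IsIntegral X]
  (A : ∀ x : X, Submodule (X.presheaf.stalk x) X.functionField)

/-- Locally constant rational functions with values in the submodules `A x`. -/
def ratSections (U : X.Opens) : AddSubgroup (U → X.functionField) where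
  carrier := { g | IsLocallyConstant g ∧ ∀ x : U, g x ∈ A x }
  zero_mem' := ⟨IsLocallyConstant.const 0, fun x => (A x).zero_mem⟩
  add_mem' h₁ h₂ := ⟨h₁.1.add h₂.1, fun x => (A x).add_mem (h₁.2 x) (h₂.2 x)⟩
  neg_mem' h := ⟨h.1.neg, fun x => (A x).neg_mem (h.2 x)⟩

instance (U : X.Opens) : SMul Γ(X, U) (ratSections A U) where
  smul r g := ⟨toRat X U r * g.1, (isLocallyConstant_toRat U r).mul g.2.1, fun x => by
    have := (A x).smul_mem (X.presheaf.germ U x.1 x.2 r) (g.2.2 x)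
    rwa [Algebra.smul_def] at this⟩

instance (U : X.Opens) : Module Γ(X, U) (ratSections A U) where
  one_smul g := Subtype.ext (by change toRat X U 1 * g.1 = g.1; rw [map_one, one_mul])
  mul_smul r s g := Subtype.ext (by
    change toRat X U (r * s) * g.1 = toRat X U r * (toRat X U s * g.1)
    rw [map_mul, mul_assoc])
  smul_zero r := Subtype.ext (mul_zero (toRat X U r))
  smul_add r g h := Subtype.ext (mul_add (toRat X U r) g.1 h.1)
  add_smul r s g := Subtype.ext (by
    change toRat X U (r + s) * g.1 = toRat X U r * g.1 + toRat X U s * g.1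
    rw [map_add, add_mul])
  zero_smul g := Subtype.ext (by change toRat X U 0 * g.1 = 0; rw [map_zero, zero_mul])

/-- Restriction of rational functions. -/
def ratRestrict {U V : X.Opens} (i : V ≤ U) : ratSections A U →+ ratSections A V where
  toFun g := ⟨fun x => g.1 ⟨x.1, i x.2⟩,
    g.2.1.comp_continuous (continuous_inclusion i), fun x => g.2.2 ⟨x.1, i x.2⟩⟩
  map_zero' := rfl
  map_add' _ _ := rfl

/-- The presheaf of abelian groups underlying `ratSheaf`. -/
def ratPresheaf : TopCat.Presheaf AddCommGrpCat.{u} X where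
  obj U := AddCommGrpCat.of (ratSections A U.unop)
  map i := AddCommGrpCat.ofHom (ratRestrict A i.unop.le)

/-- Membership in `ratSections` as a local condition. -/
def ratPredicate : TopCat.LocalPredicate (fun _ : X => (X.functionField : Type u)) where
  pred {U} g := g ∈ ratSections A U
  res {U V} i g h := (ratRestrict A i.le ⟨g, h⟩).2
  locality {U} g h := by
    refine ⟨(IsLocallyConstant.iff_exists_open g).2 fun x => ?_, fun x => ?_⟩
    · obtain ⟨V, hxV, i, hV⟩ := h x
      obtain ⟨W, hW, hxW, hc⟩ := (IsLocallyConstant.iff_exists_open _).1 hV.1 ⟨x.1, hxV⟩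
      obtain ⟨W', hW', rfl⟩ := isOpen_induced_iff.1 hW
      refine ⟨Subtype.val ⁻¹' (W' ∩ V), (hW'.inter V.isOpen).preimage continuous_subtype_val,
        ⟨hxW, hxV⟩, fun y hy => ?_⟩
      exact hc ⟨y.1, hy.2⟩ hy.1
    · obtain ⟨V, hxV, i, hV⟩ := h x
      exact hV.2 ⟨x.1, hxV⟩

lemma isSheaf_ratPresheaf : (ratPresheaf A).IsSheaf :=
  (TopCat.Presheaf.isSheaf_iff_isSheaf_comp (forget AddCommGrpCat.{u}) _).mpr
    (TopCat.Presheaf.isSheaf_of_iso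
      (NatIso.ofComponents (fun _ => Iso.refl _) :
        TopCat.subpresheafToTypes (ratPredicate A).toPrelocalPredicate ≅
          ratPresheaf A ⋙ forget AddCommGrpCat.{u})
      (TopCat.subpresheafToTypes.isSheaf (ratPredicate A)))

instance (U : (Opens X)ᵒᵖ) : Module (X.ringCatSheaf.obj.obj U) ((ratPresheaf A).obj U) :=
  inferInstanceAs (Module Γ(X, U.unop) (ratSections A U.unop))

/-- The sheaf of modules of rational functions that lie in `A x` at each point `x`. -/
def ratSheaf : X.Modules where
  val := PresheafOfModules.ofPresheaf (R := X.ringCatSheaf.obj) (ratPresheaf A) (by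
    intro U V i r g
    refine Subtype.ext (funext fun x => ?_)
    refine congrArg₂ (· * ·) (congrArg (algebraMap (X.presheaf.stalk x.1) X.functionField) ?_) rfl
    exact (X.presheaf.germ_res_apply i.unop x.1 x.2 r).symm)
  isSheaf := isSheaf_ratPresheaf A

/-- `ratSheaf` is the common form of $\mathcal O_X(aD)$ and of its pullback inside the function
field of $Y$, so one exact sequence serves both schemes. -/
lemma EffectiveCartierDivisor.sheaf_eq_ratSheaf (D : EffectiveCartierDivisor X) (a : ℤ) :
    D.sheaf a = ratSheaf (D.fractions a) :=
  rfl

/-- The inclusion of `ratSheaf A` into the constant sheaf of rational functions. -/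
def ratToConst : (SheafOfModules.toSheaf X.ringCatSheaf).obj (ratSheaf A) ⟶
    locSheaf (fun _ : X => AddMonoidHom.id X.functionField) :=
  ⟨{ app := fun U => AddCommGrpCat.ofHom
      (show ratSections A U.unop →+ locSections (fun _ : X => AddMonoidHom.id X.functionField)
          U.unop from
      { toFun := fun g => ⟨g.1, fun x => by
          obtain ⟨W, hW, hxW, hc⟩ := (IsLocallyConstant.iff_exists_open _).1 g.2.1 x
          obtain ⟨W', hW', rfl⟩ := isOpen_induced_iff.1 hW
          exact ⟨⟨W', hW'⟩, hxW, g.1 x, fun y hy => hc y hy⟩⟩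
        map_zero' := rfl
        map_add' := fun _ _ => rfl }) }⟩

/-- The quotient map from the constant sheaf of rational functions to the sheaf of rational
functions modulo `A`. -/
def constToQuot : locSheaf (fun _ : X => AddMonoidHom.id X.functionField) ⟶
    locSheaf (fun x : X => QuotientAddGroup.mk' (A x).toAddSubgroup) :=
  locSheafMap _ (fun x => QuotientAddGroup.mk' (A x).toAddSubgroup) (fun _ _ => rfl)

lemma ratToConst_comp_constToQuot : ratToConst A ≫ constToQuot A = 0 := by
  ext U g
  refine Subtype.ext (funext fun x => ?_)
  exact (QuotientAddGroup.eq_zero_iff _).2 (g.2.2 x)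

lemma shortExact_ratSheaf :
    (ShortComplex.mk _ _ (ratToConst_comp_constToQuot A)).ShortExact := by
  refine shortExact_of_sections _ ?_ ?_ ?_
  · intro U g h hgh
    exact Subtype.ext (congrArg (Subtype.val : locSections (fun _ : X =>
      AddMonoidHom.id X.functionField) U.unop → (U.unop → X.functionField)) hgh)
  · intro U b hb
    refine ⟨⟨b.1, ?_, fun x => ?_⟩, rfl⟩
    · refine (IsLocallyConstant.iff_exists_open _).2 fun x => ?_
      obtain ⟨V, hV, k, hk⟩ := b.2 x
      exact ⟨Subtype.val ⁻¹' V, V.isOpen.preimage continuous_subtype_val, hV,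
        fun y hy => (hk y hy).trans (hk x hV).symm⟩
    · exact (QuotientAddGroup.eq_zero_iff _).1 (congrFun (congrArg Subtype.val hb) x)
  · intro U c x hx
    obtain ⟨V, hV, k, hk⟩ := c.2 ⟨x, hx⟩
    refine ⟨V ⊓ U, inf_le_right, ⟨⟨fun _ => k, fun x => ⟨⊤, trivial, k, fun _ _ => rfl⟩⟩, ?_⟩,
      ⟨hV, hx⟩⟩
    exact Subtype.ext (funext fun y => (hk ⟨y.1, y.2.2⟩ y.2.1).symm)

variable {Y : Scheme.{u}} [IsIntegral Y]
  (A' : ∀ y : Y, Submodule (Y.presheaf.stalk y) Y.functionField)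

variable {A A'} in
/-- The map `ratSheaf A ⟶ π_* (ratSheaf A')` given by a map of function fields. -/
def ratPush (π : Y ⟶ X) (φ : X.functionField →+* Y.functionField)
    (hφ : ∀ (y : Y) (r : X.presheaf.stalk (π y)),
      φ (algebraMap _ X.functionField r) = algebraMap _ Y.functionField (π.stalkMap y r))
    (hA : ∀ y, ∀ c ∈ A (π y), φ c ∈ A' y) :
    ratSheaf A ⟶ (Scheme.Modules.pushforward π).obj (ratSheaf A') :=
  ⟨PresheafOfModules.homMk
    { app := fun U => AddCommGrpCat.ofHom
        (show ratSections A U.unop →+ ratSections A' (π ⁻¹ᵁ U.unop) from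
        { toFun := fun g => ⟨fun y => φ (g.1 ⟨π y, y.2⟩),
            (g.2.1.comp_continuous (f := fun y : (π ⁻¹ᵁ U.unop : Y.Opens) =>
              (⟨π y, y.2⟩ : U.unop)) (by fun_prop)).comp φ, fun y => hA y _ (g.2.2 ⟨π y, y.2⟩)⟩
          map_zero' := Subtype.ext (funext fun x => map_zero _)
          map_add' := fun _ _ => Subtype.ext (funext fun x => map_add _ _ _) }) }
    (by
      intro U r g
      refine Subtype.ext (funext fun y => ?_)
      refine (map_mul φ _ _).trans (congrArg₂ (· * ·) ?_ rfl)
      refine (hφ _ _).trans (congrArg (algebraMap (Y.presheaf.stalk y.1) Y.functionField) ?_)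
      exact π.germ_stalkMap_apply U.unop y.1 y.2 r)⟩

variable {A A'} in
/-- If pulling back `H¹(X, A)` along `π` is zero, then a global rational function modulo `A`
becomes the class of a single rational function on `Y`. -/
lemma exists_rational_of_cohPullback_eq_zero (π : Y ⟶ X)
    (φ : X.functionField →+* Y.functionField)
    (hφ : ∀ (y : Y) (r : X.presheaf.stalk (π y)),
      φ (algebraMap _ X.functionField r) = algebraMap _ Y.functionField (π.stalkMap y r))
    (hA : ∀ y, ∀ c ∈ A (π y), φ c ∈ A' y) (h : cohPullback π (ratSheaf A) 1 = 0)
    (b : X → X.functionField)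
    (hb : ∀ x, ∃ U : X.Opens, x ∈ U ∧ ∃ β, ∀ z ∈ U, b z - β ∈ A z) :
    ∃ g : Y.functionField, ∀ y, g - φ (b (π y)) ∈ A' y := by
  let c : locSections (fun x : X => QuotientAddGroup.mk' (A x).toAddSubgroup) ⊤ :=
    ⟨fun x => QuotientAddGroup.mk' (A x).toAddSubgroup (b x), fun x => by
      obtain ⟨U, hx, β, hβ⟩ := hb x
      refine ⟨U, hx, β, fun z hz => ?_⟩
      refine (QuotientAddGroup.eq_iff_sub_mem (N := (A z).toAddSubgroup)).2 (hβ z hz)⟩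
  obtain ⟨g, hg⟩ := exists_lift_of_cohPullback_eq_zero π (ratSheaf A) (ratSheaf A')
    (ratPush π φ hφ hA) (shortExact_ratSheaf A) (shortExact_ratSheaf A')
    (locSheafPush _ π φ.toAddMonoidHom (fun _ => φ.toAddMonoidHom) (fun _ _ => rfl))
    (locSheafPush _ π φ.toAddMonoidHom
      (fun y => QuotientAddGroup.map _ _ φ.toAddMonoidHom (hA y)) (fun _ _ => rfl))
    rfl rfl h c
  -- A locally constant family on the irreducible scheme `Y` is constant, because any two non-empty
  -- open sets meet.
  have hconst : ∀ x y : Y, g.1 ⟨x, trivial⟩ = g.1 ⟨y, trivial⟩ := by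
    intro x y
    obtain ⟨V, hV, k, hk⟩ := g.2 ⟨x, trivial⟩
    obtain ⟨W, hW, l, hl⟩ := g.2 ⟨y, trivial⟩
    obtain ⟨z, hzV, hzW⟩ := nonempty_preirreducible_inter V.isOpen W.isOpen ⟨x, hV⟩ ⟨y, hW⟩
    exact ((hk _ hV).trans (hk ⟨z, trivial⟩ hzV).symm).trans
      ((hl ⟨z, trivial⟩ hzW).trans (hl _ hW).symm)
  obtain ⟨y₀⟩ : Nonempty Y := inferInstance
  refine ⟨g.1 ⟨y₀, trivial⟩, fun y => ?_⟩
  rw [hconst y₀ y]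
  have := congrFun (congrArg (Subtype.val : locSections
    (fun x : Y => QuotientAddGroup.mk' (A' x).toAddSubgroup) ⊤ → _) hg) ⟨y, trivial⟩
  exact (QuotientAddGroup.eq_iff_sub_mem (N := (A' y).toAddSubgroup)).1 this

end RatSheaf

/-! ### Sections of tensor products -/

section Tensor

variable {X : Scheme.{u}}

/-- Restriction of sections of a sheaf of modules. -/
def res (M : X.Modules) {U V : X.Opens} (h : V ≤ U) : Γ(M, U) →+ Γ(M, V) :=
  (M.presheaf.map (homOfLE h).op).hom

lemma res_smul (M : X.Modules) {U V : X.Opens} (h : V ≤ U) (r : Γ(X, U)) (m : Γ(M, U)) :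
    res M h (r • m) = X.presheaf.map (homOfLE h).op r • res M h m :=
  M.map_smul _ _ _

lemma res_res (M : X.Modules) {U V W : X.Opens} (h : V ≤ U) (h' : W ≤ V) (m : Γ(M, U)) :
    res M h' (res M h m) = res M (h'.trans h) m := by
  change (M.presheaf.map (homOfLE h).op ≫ M.presheaf.map (homOfLE h').op) m = _
  rw [← M.presheaf.map_comp]
  rfl

lemma app_res {M N : X.Modules} (φ : M ⟶ N) {U V : X.Opens} (h : V ≤ U) (m : Γ(M, U)) :
    φ.app V (res M h m) = res N h (φ.app U m) :=
  NatTrans.naturality_apply φ.mapPresheaf (homOfLE h).op m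

/-- The sheafification of a presheaf of modules. -/
abbrev sheafifyModule (P : PresheafOfModules X.ringCatSheaf.obj) : X.Modules :=
  (PresheafOfModules.sheafification (𝟙 X.ringCatSheaf.obj)).obj P

/-- The section of a sheafification given by a section of the presheaf. -/
def sheafifySection (P : PresheafOfModules X.ringCatSheaf.obj) (U : X.Opens) :
    P.obj (op U) →+ Γ(sheafifyModule P, U) :=
  ((CategoryTheory.toSheafify (Opens.grothendieckTopology X) P.presheaf).app (op U)).hom

lemma sheafifySection_smul (P : PresheafOfModules X.ringCatSheaf.obj) (U : X.Opens)
    (r : X.ringCatSheaf.obj.obj (op U)) (m : P.obj (op U)) :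
    sheafifySection P U (r • m) = (show Γ(X, U) from r) • sheafifySection P U m :=
  ((PresheafOfModules.toSheafify (𝟙 X.ringCatSheaf.obj)
    (CategoryTheory.toSheafify (Opens.grothendieckTopology X) P.presheaf)).app
      (op U)).hom.map_smul r m

lemma res_sheafifySection (P : PresheafOfModules X.ringCatSheaf.obj) {U V : X.Opens} (h : V ≤ U)
    (m : P.obj (op U)) :
    res _ h (sheafifySection P U m) = sheafifySection P V (P.map (homOfLE h).op m) :=
  (NatTrans.naturality_apply (CategoryTheory.toSheafify (Opens.grothendieckTopology X) P.presheaf)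
    (homOfLE h).op m).symm

lemma exists_sheafifySection (P : PresheafOfModules X.ringCatSheaf.obj) (U : X.Opens)
    (m : Γ(sheafifyModule P, U)) (x : X)
    (hx : x ∈ U) :
    ∃ (V : X.Opens) (h : V ≤ U), (∃ n, sheafifySection P V n = res _ h m) ∧ x ∈ V :=
  (TopCat.Presheaf.isLocallySurjective_iff (X := X.carrier)
    (CategoryTheory.toSheafify (Opens.grothendieckTopology X) P.presheaf)).1
    (Presheaf.isLocallySurjective_toSheafify' ..) U m x hx

open TensorProduct in
/-- The tensor product of two sections. -/
def tmul {M N : X.Modules} {U : X.Opens} (m : Γ(M, U)) (n : Γ(N, U)) : Γ(tensor M N, U) :=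
  sheafifySection (PresheafOfModules.Monoidal.tensorObj (R := X.presheaf) M.val N.val) U
    (show (Γ(M, U) ⊗[Γ(X, U)] Γ(N, U) : Type u) from m ⊗ₜ[Γ(X, U)] n)

open TensorProduct in
lemma smul_tmul {M N : X.Modules} {U : X.Opens} (r : Γ(X, U)) (m : Γ(M, U)) (n : Γ(N, U)) :
    tmul (r • m) n = r • tmul m n :=
  (congrArg (sheafifySection (PresheafOfModules.Monoidal.tensorObj (R := X.presheaf)
    M.val N.val) U) (show (r • m) ⊗ₜ[Γ(X, U)] n = r • (m ⊗ₜ[Γ(X, U)] n) from rfl)).trans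
    (sheafifySection_smul (PresheafOfModules.Monoidal.tensorObj (R := X.presheaf) M.val N.val) U r
      (show (Γ(M, U) ⊗[Γ(X, U)] Γ(N, U) : Type u) from m ⊗ₜ[Γ(X, U)] n))

lemma tmul_smul {M N : X.Modules} {U : X.Opens} (r : Γ(X, U)) (m : Γ(M, U)) (n : Γ(N, U)) :
    tmul m (r • n) = r • tmul m n := by
  rw [← smul_tmul]
  exact congrArg (sheafifySection (PresheafOfModules.Monoidal.tensorObj (R := X.presheaf)
    M.val N.val) U) (TensorProduct.smul_tmul r m n).symm

lemma res_tmul {M N : X.Modules} {U V : X.Opens} (h : V ≤ U) (m : Γ(M, U)) (n : Γ(N, U)) :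
    res _ h (tmul m n) = tmul (res M h m) (res N h n) :=
  res_sheafifySection (PresheafOfModules.Monoidal.tensorObj (R := X.presheaf) M.val N.val) h _

/-- The tensor power of a section. -/
def spow {M : X.Modules} {U : X.Opens} (m : Γ(M, U)) : ∀ n : ℕ, Γ(tensorPow M n, U)
  | 0 => (1 : Γ(X, U))
  | n + 1 => tmul m (spow m n)

lemma spow_smul {M : X.Modules} {U : X.Opens} (r : Γ(X, U)) (m : Γ(M, U)) (n : ℕ) :
    spow (r • m) n = r ^ n • spow m n := by
  induction n with
  | zero => rw [pow_zero, one_smul]; rfl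
  | succ n ih =>
    change tmul (r • m) (spow (r • m) n) = r ^ (n + 1) • tmul m (spow m n)
    rw [ih, smul_tmul, tmul_smul, smul_smul, pow_succ']

lemma res_spow {M : X.Modules} {U V : X.Opens} (h : V ≤ U) (m : Γ(M, U)) (n : ℕ) :
    res _ h (spow m n) = spow (res M h m) n := by
  induction n with
  | zero => exact map_one (X.presheaf.map (homOfLE h).op).hom
  | succ n ih =>
    change res _ h (tmul m (spow m n)) = tmul (res M h m) (spow (res M h m) n)
    rw [res_tmul, ih]

/-- The section `m` generates `M` locally: every section is locally a multiple of `m`. -/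
def Generates (M : X.Modules) {U : X.Opens} (m : Γ(M, U)) : Prop :=
  ∀ (V : X.Opens) (h : V ≤ U) (n : Γ(M, V)), ∀ x ∈ V, ∃ (W : X.Opens) (h' : W ≤ V) (r : Γ(X, W)),
    x ∈ W ∧ res M h' n = r • res M (h'.trans h) m

-- A section of the sheafified tensor product is locally a finite sum of pure tensors. For these,
-- the coefficients with respect to `m` and `n` multiply, and sums are handled on intersections of
-- neighbourhoods.
open TensorProduct in
lemma Generates.tmul {M N : X.Modules} {U : X.Opens} {m : Γ(M, U)} {n : Γ(N, U)}
    (hm : Generates M m) (hn : Generates N n) : Generates (tensor M N) (tmul m n) := by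
  intro V h t x hx
  obtain ⟨V', h', ⟨t', ht'⟩, hxV'⟩ := exists_sheafifySection
    (PresheafOfModules.Monoidal.tensorObj (R := X.presheaf) M.val N.val) V t x hx
  suffices H : ∃ (W : X.Opens) (h'' : W ≤ V') (r : Γ(X, W)), x ∈ W ∧
      res (tensor M N) h'' (sheafifySection
        (PresheafOfModules.Monoidal.tensorObj (R := X.presheaf) M.val N.val) V' t') =
        r • res (tensor M N) (h''.trans (h'.trans h)) (NefLineBundles.tmul m n) by
    obtain ⟨W, h'', r, hxW, hr⟩ := H
    refine ⟨W, h''.trans h', r, hxW, ?_⟩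
    rw [← hr, ht']
    exact (res_res (tensor M N) h' h'' t).symm
  change (Γ(M, V') ⊗[Γ(X, V')] Γ(N, V') : Type u) at t'
  clear ht'
  induction t' using TensorProduct.induction_on with
  | zero =>
    refine ⟨V', le_rfl, 0, hxV', ?_⟩
    rw [zero_smul]
    exact (congrArg _ (map_zero _)).trans (map_zero _)
  | tmul a b =>
    obtain ⟨W₁, h₁, r, hx₁, hr⟩ := hm V' (h'.trans h) a x hxV'
    obtain ⟨W₂, h₂, s, hx₂, hs⟩ := hn V' (h'.trans h) b x hxV'
    have l₁ : W₁ ⊓ W₂ ≤ W₁ := inf_le_left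
    have l₂ : W₁ ⊓ W₂ ≤ W₂ := inf_le_right
    refine ⟨W₁ ⊓ W₂, l₁.trans h₁, X.presheaf.map (homOfLE l₁).op r *
      X.presheaf.map (homOfLE l₂).op s, ⟨hx₁, hx₂⟩, ?_⟩
    refine (res_tmul (l₁.trans h₁) a b).trans ?_
    have ha := congrArg (res M l₁) hr
    have hb := congrArg (res N l₂) hs
    rw [res_smul, res_res, res_res] at ha hb
    rw [ha, hb, smul_tmul, tmul_smul, smul_smul, res_tmul]
  | add a b iha ihb =>
    obtain ⟨W₁, h₁, r, hx₁, hr⟩ := iha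
    obtain ⟨W₂, h₂, s, hx₂, hs⟩ := ihb
    have l₁ : W₁ ⊓ W₂ ≤ W₁ := inf_le_left
    have l₂ : W₁ ⊓ W₂ ≤ W₂ := inf_le_right
    refine ⟨W₁ ⊓ W₂, l₁.trans h₁, X.presheaf.map (homOfLE l₁).op r +
      X.presheaf.map (homOfLE l₂).op s, ⟨hx₁, hx₂⟩, ?_⟩
    have ha := congrArg (res (tensor M N) l₁) hr
    have hb := congrArg (res (tensor M N) l₂) hs
    rw [res_smul, res_res] at ha hb
    rw [add_smul]
    refine ((congrArg _ (map_add _ _ _)).trans (map_add _ _ _)).trans ?_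
    refine congrArg₂ (· + ·) ?_ ?_
    · exact (res_res (tensor M N) h₁ l₁ _).symm.trans ha
    · exact (res_res (tensor M N) h₂ l₂ _).symm.trans hb

lemma Generates.spow {M : X.Modules} {U : X.Opens} {m : Γ(M, U)} (hm : Generates M m) (n : ℕ) :
    Generates (tensorPow M n) (spow m n) := by
  induction n with
  | zero =>
    intro V h t x hx
    refine ⟨V, le_rfl, t, hx, ?_⟩
    have h₁ : res (tensorPow M 0) h (NefLineBundles.spow m 0) = (1 : Γ(X, V)) :=
      map_one (X.presheaf.map (homOfLE h).op).hom
    have h₂ : res (tensorPow M 0) le_rfl t = t := by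
      refine (DFunLike.congr_fun (congrArg AddCommGrpCat.Hom.hom
        ((tensorPow M 0).presheaf.map_id (op V))) t)
    rw [h₁, h₂]
    exact (mul_one (show Γ(X, V) from t)).symm
  | succ n ih => exact hm.tmul ih

lemma Generates.app {M N : X.Modules} (φ : M ≅ N) {U : X.Opens} {m : Γ(M, U)}
    (hm : Generates M m) : Generates N (φ.hom.app U m) := by
  intro V h n x hx
  obtain ⟨W, h', r, hxW, hr⟩ := hm V h (φ.inv.app V n) x hx
  refine ⟨W, h', r, hxW, ?_⟩
  have := congrArg (φ.hom.app W) hr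
  rw [Scheme.Modules.Hom.app_smul, app_res, app_res] at this
  rw [← this]
  have e : (φ.inv ≫ φ.hom).app V n = n := by rw [φ.inv_hom_id]; rfl
  exact congrArg _ e.symm

end Tensor

/-! ### Generators of inverse images -/

section Generators

variable {X : Scheme.{u}}

/-- The section `n` is a multiple of `m`, locally at all points where `m` is defined. -/
def IsLocallyMultiple {N : X.Modules} {U : X.Opens} (m : Γ(N, U)) {V : X.Opens}
    (n : Γ(N, V)) : Prop :=
  ∀ x ∈ V, x ∈ U → ∃ (W : X.Opens) (h : W ≤ V) (h' : W ≤ U) (r : Γ(X, W)),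
    x ∈ W ∧ res N h n = r • res N h' m

lemma IsLocallyMultiple.res {N : X.Modules} {U : X.Opens} {m : Γ(N, U)} {V V' : X.Opens}
    {n : Γ(N, V)} (hn : IsLocallyMultiple m n) (h : V' ≤ V) :
    IsLocallyMultiple m (res N h n) := by
  intro x hx hxU
  obtain ⟨W, h₁, h₂, r, hxW, hr⟩ := hn x (h hx) hxU
  have l : W ⊓ V' ≤ W := inf_le_left
  refine ⟨W ⊓ V', inf_le_right, l.trans h₂, X.presheaf.map (homOfLE l).op r, ⟨hxW, hx⟩, ?_⟩
  have := congrArg (NefLineBundles.res N l) hr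
  rw [res_smul, res_res, res_res] at this
  rw [res_res, ← this]

lemma IsLocallyMultiple.add {N : X.Modules} {U : X.Opens} {m : Γ(N, U)} {V : X.Opens}
    {n n' : Γ(N, V)} (hn : IsLocallyMultiple m n) (hn' : IsLocallyMultiple m n') :
    IsLocallyMultiple m (n + n') := by
  intro x hx hxU
  obtain ⟨W₁, h₁, k₁, r, hx₁, hr⟩ := hn x hx hxU
  obtain ⟨W₂, h₂, k₂, s, hx₂, hs⟩ := hn' x hx hxU
  have l₁ : W₁ ⊓ W₂ ≤ W₁ := inf_le_left
  have l₂ : W₁ ⊓ W₂ ≤ W₂ := inf_le_right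
  refine ⟨W₁ ⊓ W₂, l₁.trans h₁, l₁.trans k₁, X.presheaf.map (homOfLE l₁).op r +
    X.presheaf.map (homOfLE l₂).op s, ⟨hx₁, hx₂⟩, ?_⟩
  have ha := congrArg (NefLineBundles.res N l₁) hr
  have hb := congrArg (NefLineBundles.res N l₂) hs
  rw [res_smul, res_res, res_res] at ha hb
  rw [map_add, add_smul, ha, hb]

lemma IsLocallyMultiple.smul {N : X.Modules} {U : X.Opens} {m : Γ(N, U)} {V : X.Opens}
    {n : Γ(N, V)} (hn : IsLocallyMultiple m n) (s : Γ(X, V)) : IsLocallyMultiple m (s • n) := by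
  intro x hx hxU
  obtain ⟨W, h, k, r, hxW, hr⟩ := hn x hx hxU
  refine ⟨W, h, k, X.presheaf.map (homOfLE h).op s * r, hxW, ?_⟩
  rw [res_smul, hr, smul_smul]

/-- The submodule of sections that are locally multiples of `m`. -/
def multiples (N : X.Modules) {U : X.Opens} (m : Γ(N, U)) : N.val.Submodule where
  obj V :=
    { carrier := { n | IsLocallyMultiple m (V := V.unop) n }
      zero_mem' := fun x hx hxU => ⟨V.unop ⊓ U, inf_le_left, inf_le_right, 0, ⟨hx, hxU⟩, by
        rw [zero_smul]; exact map_zero _⟩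
      add_mem' := fun h h' => h.add h'
      smul_mem' := fun r n h => h.smul r }
  map {V W} f n hn := IsLocallyMultiple.res hn f.unop.le

/-- The presheaf of abelian groups of sections that are locally multiples of `m`. -/
abbrev multiplesPresheaf (N : X.Modules) {U : X.Opens} (m : Γ(N, U)) :
    TopCat.Presheaf AddCommGrpCat.{u} X :=
  (multiples N m).toPresheafOfModules.presheaf

/-- Being a multiple is only required locally, so the glued section in `N` stays in the submodule.
-/
lemma multiples_isSheaf (N : X.Modules) {U : X.Opens} (m : Γ(N, U)) :
    (multiplesPresheaf N m).IsSheaf := by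
  rw [TopCat.Presheaf.isSheaf_iff_isSheafUniqueGluing]
  intro ι V sf' hsf
  let sf : ∀ i, (multiples N m).obj (op (V i)) := sf'
  have hc : TopCat.Presheaf.IsCompatible N.presheaf V
      (fun i => (sf i).1) := fun i j =>
    congrArg (Subtype.val : (multiples N m).obj (op (V i ⊓ V j)) → _) (hsf i j)
  obtain ⟨s, hs, hu⟩ := N.isSheaf.isSheafUniqueGluing V _ hc
  refine ⟨⟨s, ?_⟩, fun i => Subtype.ext (hs i), fun t ht => Subtype.ext (hu t.1 fun i => ?_)⟩
  · intro x hx hxU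
    obtain ⟨i, hi⟩ := Opens.mem_iSup.1 hx
    obtain ⟨W, h, k, r, hxW, hr⟩ := (sf i).2 x hi hxU
    refine ⟨W, h.trans (le_iSup V i), k, r, hxW, ?_⟩
    rw [← hr]
    exact (res_res N (le_iSup V i) h s).symm.trans (congrArg (res N h) (hs i))
  · exact congrArg (Subtype.val : (multiples N m).obj (op (V i)) → _) (ht i)

/-- The sheaf of modules of sections that are locally multiples of `m`. -/
def multiplesSheaf (N : X.Modules) {U : X.Opens} (m : Γ(N, U)) : X.Modules where
  val := (multiples N m).toPresheafOfModules
  isSheaf := multiples_isSheaf N m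

/-- The inclusion of the sheaf of sections that are locally multiples of `m`. -/
def multiplesι (N : X.Modules) {U : X.Opens} (m : Γ(N, U)) : multiplesSheaf N m ⟶ N :=
  ⟨(multiples N m).ι⟩

variable {Z : Scheme.{u}} (f : Z ⟶ X)

/-- The inverse image of a section. -/
def pullSection {M : X.Modules} {U : X.Opens} (m : Γ(M, U)) :
    Γ((Scheme.Modules.pullback f).obj M, f ⁻¹ᵁ U) :=
  ((Scheme.Modules.pullbackPushforwardAdjunction f).unit.app M).app U m

lemma pullSection_smul {M : X.Modules} {U : X.Opens} (r : Γ(X, U)) (m : Γ(M, U)) :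
    pullSection f (r • m) = f.app U r • pullSection f m :=
  Scheme.Modules.Hom.app_smul _ _ _

lemma pullSection_res {M : X.Modules} {U V : X.Opens} (h : V ≤ U) (m : Γ(M, U)) :
    pullSection f (res M h m) = res _ (f.preimage_mono h) (pullSection f m) :=
  app_res ((Scheme.Modules.pullbackPushforwardAdjunction f).unit.app M) h m

lemma Generates.isLocallyMultiple_pullSection {M : X.Modules} {U : X.Opens} {m : Γ(M, U)}
    (hm : Generates M m) {V : X.Opens} (n : Γ(M, V)) :
    IsLocallyMultiple (pullSection f m) (pullSection f n) := by
  intro z hz hzU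
  have l : V ⊓ U ≤ V := inf_le_left
  have l' : V ⊓ U ≤ U := inf_le_right
  obtain ⟨W, h, r, hxW, hr⟩ := hm (V ⊓ U) l' (res M l n) (f z) ⟨hz, hzU⟩
  refine ⟨f ⁻¹ᵁ W, f.preimage_mono (h.trans l), f.preimage_mono (h.trans l'), f.app W r, hxW, ?_⟩
  have := congrArg (pullSection f) hr
  rw [pullSection_smul, pullSection_res, pullSection_res, pullSection_res, res_res] at this
  exact this

/-- The inverse image of sections, with values in the multiples of a generator. -/
def toMultiples {M : X.Modules} {U : X.Opens} {m : Γ(M, U)} (hm : Generates M m) :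
    M ⟶ (Scheme.Modules.pushforward f).obj (multiplesSheaf _ (pullSection f m)) :=
  ⟨PresheafOfModules.homMk
    { app := fun V => AddCommGrpCat.ofHom
        (show Γ(M, V.unop) →+ (multiples _ (pullSection f m)).obj (op (f ⁻¹ᵁ V.unop)) from
        { toFun := fun n => ⟨pullSection f n, hm.isLocallyMultiple_pullSection f n⟩
          map_zero' := Subtype.ext (map_zero _)
          map_add' := fun _ _ => Subtype.ext (map_add _ _ _) })
      naturality := fun V W i => by
        ext n
        exact Subtype.ext (pullSection_res f i.unop.le n) }
    (fun V r n => Subtype.ext (pullSection_smul f r n))⟩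

/-- The unit $M\to f_*f^*M$ takes values in the subsheaf of local multiples of the pulled back
generator. By adjunction the identity of $f^*M$ factors through this subsheaf, so the subsheaf is
everything. No stalks of $f^*M$ are needed. -/
lemma Generates.pullSection {M : X.Modules} {U : X.Opens} {m : Γ(M, U)} (hm : Generates M m) :
    Generates _ (pullSection f m) := by
  let adj := Scheme.Modules.pullbackPushforwardAdjunction f
  let k := (adj.homEquiv _ _).symm (toMultiples f hm)
  have hk : k ≫ multiplesι _ (NefLineBundles.pullSection f m) = 𝟙 _ := by
    apply (adj.homEquiv _ _).injective
    rw [adj.homEquiv_naturality_right, Equiv.apply_symm_apply, adj.homEquiv_id]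
    rfl
  intro V h n x hx
  have hn : (k ≫ multiplesι _ (NefLineBundles.pullSection f m)).app V n = n := by rw [hk]; rfl
  have key : IsLocallyMultiple (NefLineBundles.pullSection f m) n := by
    rw [← hn]
    exact (show (multiples _ (NefLineBundles.pullSection f m)).obj (op V) from k.app V n).2
  obtain ⟨W, h₁, h₂, r, hxW, hr⟩ := key x hx (h hx)
  exact ⟨W, h₁, r, hxW, hr⟩

end Generators

/-! ### Local equations of a divisor -/

section RationalFunctions

variable {X : Scheme.{u}} [IsIntegral X]

/-- A regular function near `x`, as a rational function. -/
def fn {U : X.Opens} {x : X} (hx : x ∈ U) : Γ(X, U) →+* X.functionField :=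
  (algebraMap (X.presheaf.stalk x) X.functionField).comp (X.presheaf.germ U x hx).hom

/-- The local ring of `x`, as a subring of the function field. -/
abbrev localRing (x : X) : Subring X.functionField :=
  (algebraMap (X.presheaf.stalk x) X.functionField).range

lemma fn_mem {U : X.Opens} {x : X} (hx : x ∈ U) (r : Γ(X, U)) : fn hx r ∈ localRing x := ⟨_, rfl⟩

lemma fn_eq {U : X.Opens} {x y : X} (hx : x ∈ U) (hy : y ∈ U) (r : Γ(X, U)) :
    fn hx r = fn hy r := by
  have : Nonempty U := ⟨⟨x, hx⟩⟩
  exact (Scheme.algebraMap_germ_eq_germToFunctionField X hx r).trans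
    (Scheme.algebraMap_germ_eq_germToFunctionField X hy r).symm

lemma fn_res {U V : X.Opens} {x : X} (h : V ≤ U) (hx : x ∈ V) (r : Γ(X, U)) :
    fn hx (X.presheaf.map (homOfLE h).op r) = fn (h hx) r :=
  congrArg (algebraMap (X.presheaf.stalk x) X.functionField)
    (X.presheaf.germ_res_apply (homOfLE h) x hx r)

lemma algebraMap_stalk_injective (x : X) :
    Function.Injective (algebraMap (X.presheaf.stalk x) X.functionField) :=
  IsFractionRing.injective _ _

lemma fn_injective {U : X.Opens} {x : X} (hx : x ∈ U) :
    Function.Injective (fn hx : Γ(X, U) → X.functionField) :=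
  (algebraMap_stalk_injective x).comp (germ_injective_of_isIntegral X x hx)

lemma exists_fn_eq {x : X} {c : X.functionField} (hc : c ∈ localRing x) :
    ∃ (U : X.Opens) (hx : x ∈ U) (r : Γ(X, U)), fn hx r = c := by
  obtain ⟨t, rfl⟩ := hc
  obtain ⟨U, hx, r, rfl⟩ := X.presheaf.exists_germ_eq t
  exact ⟨U, hx, r, rfl⟩

lemma zpow_mem_of_mul_eq_one {K : Type*} [Field K] {S : Subring K} {e e' : K} (he : e ∈ S)
    (he' : e' ∈ S) (h : e * e' = 1) (a : ℤ) : e ^ a ∈ S := by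
  obtain ⟨n, rfl | rfl⟩ := a.eq_nat_or_neg
  · rw [zpow_natCast]; exact pow_mem he n
  · rw [zpow_neg, ← inv_zpow, zpow_natCast, ← eq_inv_of_mul_eq_one_right h]
    exact pow_mem he' n

end RationalFunctions

namespace EffectiveCartierDivisor

/-- On a small affine neighbourhood in the overlap both equations generate the same ideal, so each
divides the other. On an integral scheme `e` and `e'` are then mutually inverse. -/
lemma exists_factor {X : Scheme.{u}} (D : EffectiveCartierDivisor X)
    {U V : X.affineOpens} {f : Γ(X, U)} {g : Γ(X, V)}
    (hf : D.ideal.ideal U = Ideal.span {f}) (hg : D.ideal.ideal V = Ideal.span {g}) {y : X}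
    (hU : y ∈ U.1) (hV : y ∈ V.1) :
    ∃ (W : X.affineOpens) (l : W.1 ≤ U.1) (l' : W.1 ≤ V.1) (e e' : Γ(X, W)), y ∈ W.1 ∧
      D.ideal.ideal W = Ideal.span {X.presheaf.map (homOfLE l).op f} ∧
      D.ideal.ideal W = Ideal.span {X.presheaf.map (homOfLE l').op g} ∧
      X.presheaf.map (homOfLE l').op g = X.presheaf.map (homOfLE l).op f * e ∧
      X.presheaf.map (homOfLE l).op f = X.presheaf.map (homOfLE l').op g * e' := by
  obtain ⟨W, hW, hyW, hWUV⟩ := X.isBasis_affineOpens.exists_subset_of_mem_open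
    (show y ∈ (U.1 ⊓ V.1 : X.Opens) from ⟨hU, hV⟩) (U.1 ⊓ V.1 : X.Opens).isOpen
  obtain ⟨W, hWa, rfl⟩ := hW
  have l : W ≤ U.1 := fun z hz => (hWUV hz).1
  have l' : W ≤ V.1 := fun z hz => (hWUV hz).2
  have h₁ : D.ideal.ideal ⟨W, hWa⟩ = Ideal.span {X.presheaf.map (homOfLE l).op f} := by
    rw [← D.ideal.map_ideal (U := ⟨W, hWa⟩) (V := U) l, hf, Ideal.map_span, Set.image_singleton]
    rfl
  have h₂ : D.ideal.ideal ⟨W, hWa⟩ = Ideal.span {X.presheaf.map (homOfLE l').op g} := by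
    rw [← D.ideal.map_ideal (U := ⟨W, hWa⟩) (V := V) l', hg, Ideal.map_span, Set.image_singleton]
    rfl
  obtain ⟨e, he⟩ := Ideal.mem_span_singleton.1
    (h₁ ▸ h₂ ▸ Ideal.mem_span_singleton_self (X.presheaf.map (homOfLE l').op g))
  obtain ⟨e', he'⟩ := Ideal.mem_span_singleton.1
    (h₂ ▸ h₁ ▸ Ideal.mem_span_singleton_self (X.presheaf.map (homOfLE l).op f))
  exact ⟨⟨W, hWa⟩, l, l', e, e', hyW, h₁, h₂, he, he'⟩

variable {X : Scheme.{u}} [IsIntegral X] (D : EffectiveCartierDivisor X)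

lemma exists_equation (x : X) : ∃ (U : X.affineOpens) (hx : x ∈ U.1) (f : Γ(X, U)),
    D.ideal.ideal U = Ideal.span {f} ∧ fn hx f ≠ 0 := by
  obtain ⟨U, hx, f, hf, h⟩ := D.locally_principal x
  have : Nonempty U.1 := ⟨⟨x, hx⟩⟩
  exact ⟨U, hx, f, h, (map_ne_zero_iff _ (fn_injective hx)).2 (nonZeroDivisors.ne_zero hf)⟩

lemma fn_ne_zero {U : X.affineOpens} {f : Γ(X, U)} (hf : D.ideal.ideal U = Ideal.span {f})
    {x : X} (hx : x ∈ U.1) : fn hx f ≠ 0 := by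
  obtain ⟨V, hxV, g, hg, hg0⟩ := D.exists_equation x
  obtain ⟨W, l, l', e, e', hxW, -, -, he, -⟩ := D.exists_factor hf hg hx hxV
  have := congrArg (fn hxW) he
  rw [map_mul, fn_res, fn_res] at this
  rw [this] at hg0
  exact left_ne_zero_of_mul hg0

/-- Two local equations at `x` differ by a unit of the local ring. -/
lemma exists_unit {U V : X.affineOpens} {f : Γ(X, U)} {g : Γ(X, V)}
    (hf : D.ideal.ideal U = Ideal.span {f}) (hg : D.ideal.ideal V = Ideal.span {g}) {x : X}
    (hU : x ∈ U.1) (hV : x ∈ V.1) :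
    ∃ e ∈ localRing x, ∃ e' ∈ localRing x, e * e' = 1 ∧ fn hV g = fn hU f * e := by
  obtain ⟨W, l, l', e, e', hxW, -, -, he, he'⟩ := D.exists_factor hf hg hU hV
  have h := congrArg (fn hxW) he
  have h' := congrArg (fn hxW) he'
  rw [map_mul, fn_res, fn_res] at h h'
  refine ⟨fn hxW e, fn_mem _ _, fn hxW e', fn_mem _ _, ?_, h⟩
  rw [h, mul_assoc] at h'
  exact (mul_eq_left₀ (D.fn_ne_zero hf hU)).1 h'.symm

/-- One local equation suffices, because another differs from it by a unit of the local ring. -/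
lemma mem_fractions_iff {a : ℤ} {U : X.affineOpens} {f : Γ(X, U)}
    (hf : D.ideal.ideal U = Ideal.span {f}) {x : X} (hx : x ∈ U.1) {c : X.functionField} :
    c ∈ D.fractions a x ↔ c * fn hx f ^ a ∈ localRing x := by
  refine ⟨fun h => h U hx f hf, fun h V hV g hg => ?_⟩
  obtain ⟨e, he, e', he', hee', heq⟩ := D.exists_unit hf hg hx hV
  change c * fn hV g ^ a ∈ localRing x
  rw [heq, mul_zpow, ← mul_assoc]
  exact mul_mem h (zpow_mem_of_mul_eq_one he he' hee' a)

/-- The section `1 / f` of `𝒪_X(D)`, for a local equation `f` of `D`. -/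
def invSection {U : X.affineOpens} {f : Γ(X, U)} (hf : D.ideal.ideal U = Ideal.span {f})
    {x : X} (hx : x ∈ U.1) : Γ(D.sheaf 1, U) :=
  show D.sections 1 U.1 from ⟨fun _ => (fn hx f)⁻¹, IsLocallyConstant.const _, fun y => by
    rw [D.mem_fractions_iff hf y.2, zpow_one, fn_eq hx y.2,
      inv_mul_cancel₀ (D.fn_ne_zero hf y.2)]
    exact one_mem _⟩

lemma generates_invSection {U : X.affineOpens} {f : Γ(X, U)}
    (hf : D.ideal.ideal U = Ideal.span {f}) {x : X} (hx : x ∈ U.1) :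
    Generates (D.sheaf 1) (D.invSection hf hx) := by
  intro V h n y hy
  change D.sections 1 V at n
  obtain ⟨W, hW, hyW, hc⟩ := (IsLocallyConstant.iff_exists_open _).1 n.2.1 ⟨y, hy⟩
  obtain ⟨W, hW', rfl⟩ := isOpen_induced_iff.1 hW
  have hn := (D.mem_fractions_iff hf (h hy)).1 (n.2.2 ⟨y, hy⟩)
  rw [zpow_one] at hn
  obtain ⟨W', hyW', r, hr⟩ := exists_fn_eq hn
  let T : X.Opens := ⟨W, hW'⟩ ⊓ W' ⊓ V
  have l : T ≤ W' := fun z hz => hz.1.2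
  refine ⟨T, inf_le_right, X.presheaf.map (homOfLE l).op r, ⟨⟨hyW, hyW'⟩, hy⟩, ?_⟩
  refine Subtype.ext (funext fun z => ?_)
  change n.1 ⟨z.1, z.2.2⟩ = fn z.2 (X.presheaf.map (homOfLE l).op r) * (fn hx f)⁻¹
  rw [fn_res, fn_eq _ hyW', hr, fn_eq hx (h hy), mul_inv_cancel_right₀ (D.fn_ne_zero hf (h hy))]
  exact hc ⟨z.1, z.2.2⟩ z.2.1.1

lemma res_invSection {U V : X.affineOpens} {f : Γ(X, U)} {g : Γ(X, V)}
    (hf : D.ideal.ideal U = Ideal.span {f}) (hg : D.ideal.ideal V = Ideal.span {g}) {x x' : X}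
    (hx : x ∈ U.1) (hx' : x' ∈ V.1) {W : X.affineOpens} (l : W.1 ≤ U.1) (l' : W.1 ≤ V.1)
    {e : Γ(X, W)} (he : X.presheaf.map (homOfLE l').op g = X.presheaf.map (homOfLE l).op f * e) :
    res _ l (D.invSection hf hx) = e • res _ l' (D.invSection hg hx') := by
  refine Subtype.ext (funext fun z => ?_)
  change (fn hx f)⁻¹ = fn z.2 e * (fn hx' g)⁻¹
  have := congrArg (fn z.2) he
  rw [map_mul, fn_res, fn_res] at this
  rw [fn_eq hx (l z.2), fn_eq hx' (l' z.2), this, mul_inv, mul_left_comm, mul_inv_cancel₀, mul_one]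
  rintro h0
  rw [h0, mul_zero] at this
  exact D.fn_ne_zero hg (l' z.2) this

end EffectiveCartierDivisor

/-! ### Trivializations of powers of $L|_D$ and their local lifts -/

lemma isUnit_of_generates {Z : Scheme.{u}} {U : Z.Opens} (w : Γ(Z, U))
    (hw : Generates (structureModule Z) (U := U) w) : IsUnit w := by
  refine Z.toRingedSpace.isUnit_of_isUnit_germ U w fun z hz => ?_
  obtain ⟨W, h, r, hzW, hr⟩ := hw U le_rfl (1 : Γ(Z, U)) z hz
  have h₁ : (1 : Γ(Z, W)) = r * Z.presheaf.map (homOfLE h).op w :=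
    (map_one (Z.presheaf.map (homOfLE h).op).hom).symm.trans hr
  have h₂ := congrArg (Z.presheaf.germ W z hzW) h₁
  rw [map_one, map_mul] at h₂
  have h₃ : Z.presheaf.germ W z hzW (Z.presheaf.map (homOfLE h).op w) = Z.presheaf.germ U z hz w :=
    Z.presheaf.germ_res_apply (homOfLE h) z hzW w
  rw [h₃] at h₂
  exact IsUnit.of_mul_eq_one_right _ h₂.symm

lemma app_res_eq {X Z : Scheme.{u}} (i : Z ⟶ X) {U V : X.Opens} (l : V ≤ U) (r : Γ(X, U)) :
    i.app V (X.presheaf.map (homOfLE l).op r) =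
      Z.presheaf.map (homOfLE (i.preimage_mono l)).op (i.app U r) :=
  NatTrans.naturality_apply i.c (homOfLE l).op r

namespace EffectiveCartierDivisor

variable {X : Scheme.{u}} [IsIntegral X] (D : EffectiveCartierDivisor X)

section

variable {n : ℕ} (α : tensorPow ((Scheme.Modules.pullback D.incl).obj (D.sheaf 1)) n ≅
  structureModule D.toScheme)

/-- The function on `D` that corresponds to the `n`-th power of `1 / f` under a trivialization of
`𝒪_X(D)|_D^{⊗ n}`. -/
def trivFn {U : X.affineOpens} {f : Γ(X, U)} (hf : D.ideal.ideal U = Ideal.span {f})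
    {x : X} (hx : x ∈ U.1) : Γ(D.toScheme, D.incl ⁻¹ᵁ U.1) :=
  α.hom.app _ (spow (pullSection D.incl (D.invSection hf hx)) n)

lemma isUnit_trivFn {U : X.affineOpens} {f : Γ(X, U)} (hf : D.ideal.ideal U = Ideal.span {f})
    {x : X} (hx : x ∈ U.1) : IsUnit (D.trivFn α hf hx) :=
  isUnit_of_generates _ ((((D.generates_invSection hf hx).pullSection D.incl).spow n).app α)

/-- If $g=fe$ then $1/f=e\cdot(1/g)$, so the $n$-th powers differ by $e^n$. Thus $\tau_f f^n$, with
$\tau_f$ the function `trivFn`, is independent of $f$ as a section of $\mathcal O_X(-nD)|_D$. -/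
lemma res_trivFn {U V : X.affineOpens} {f : Γ(X, U)} {g : Γ(X, V)}
    (hf : D.ideal.ideal U = Ideal.span {f}) (hg : D.ideal.ideal V = Ideal.span {g}) {x x' : X}
    (hx : x ∈ U.1) (hx' : x' ∈ V.1) {W : X.affineOpens} (l : W.1 ≤ U.1) (l' : W.1 ≤ V.1)
    {e : Γ(X, W)} (he : X.presheaf.map (homOfLE l').op g = X.presheaf.map (homOfLE l).op f * e) :
    D.toScheme.presheaf.map (homOfLE (D.incl.preimage_mono l)).op (D.trivFn α hf hx) =
      D.incl.app W e ^ n *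
        D.toScheme.presheaf.map (homOfLE (D.incl.preimage_mono l')).op (D.trivFn α hg hx') := by
  have h₁ := congrArg (fun m => α.hom.app _ (spow (pullSection D.incl m) n))
    (D.res_invSection hf hg hx hx' l l' he)
  dsimp only at h₁
  rw [pullSection_smul, spow_smul, Scheme.Modules.Hom.app_smul, pullSection_res, pullSection_res,
    ← res_spow, ← res_spow, app_res, app_res] at h₁
  exact h₁

/-- The values at `y` of two local lifts of a nowhere vanishing section of `𝒪_X(±nD)|_D` differ by
an element of `𝒪_X(±nD - D)`. -/
lemma trivFn_lift_sub_mem {U V : X.affineOpens} {f v w : Γ(X, U)} {g v' w' : Γ(X, V)}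
    (hf : D.ideal.ideal U = Ideal.span {f}) (hg : D.ideal.ideal V = Ideal.span {g}) {x x' : X}
    (hx : x ∈ U.1) (hx' : x' ∈ V.1)
    (hv : D.incl.app U v = D.trivFn α hf hx) (hv' : D.incl.app V v' = D.trivFn α hg hx')
    (hw : D.incl.app U w * D.trivFn α hf hx = 1) (hw' : D.incl.app V w' * D.trivFn α hg hx' = 1)
    {y : X} (hU : y ∈ U.1) (hV : y ∈ V.1) :
    fn hU v * fn hU f ^ (n : ℤ) - fn hV v' * fn hV g ^ (n : ℤ) ∈ D.fractions (-(n : ℤ) - 1) y ∧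
    fn hU w * fn hU f ^ (-(n : ℤ)) - fn hV w' * fn hV g ^ (-(n : ℤ)) ∈
      D.fractions ((n : ℤ) - 1) y := by
  obtain ⟨W, l, l', e, e', hyW, h₁, -, he, he'⟩ := D.exists_factor hf hg hU hV
  have hτ := D.res_trivFn α hf hg hx hx' l l' he
  have hF := D.fn_ne_zero hf hU
  have hee : e * e' = 1 := by
    have h := congrArg (fn hyW) he
    have h' := congrArg (fn hyW) he'
    rw [map_mul, fn_res, fn_res] at h h'
    apply fn_injective hyW
    rw [map_mul, map_one]
    rw [h, mul_assoc] at h'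
    exact (mul_eq_left₀ hF).1 h'.symm
  have hE : fn hV g = fn hU f * fn hyW e := by
    have h := congrArg (fn hyW) he
    rwa [map_mul, fn_res, fn_res] at h
  have hE' : fn hyW e * fn hyW e' = 1 := by rw [← map_mul, hee, map_one]
  -- The kernel of restriction to `D` is generated by `f` on `W`; this supplies the extra factor
  -- `f`, the `-1` in both twists.
  have mem : ∀ s : Γ(X, W), D.incl.app W s = 0 → ∃ t, s = X.presheaf.map (homOfLE l).op f * t := by
    intro s hs
    have : s ∈ D.ideal.ideal W := by
      rw [← D.ideal.ker_subschemeι_app]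
      exact hs
    rw [h₁] at this
    exact Ideal.mem_span_singleton.1 this
  rw [D.mem_fractions_iff hf hU, D.mem_fractions_iff hf hU]
  constructor
  -- On `D` the lift `v` equals `e ^ n * v'`, which matches `g ^ n = f ^ n * e ^ n`.
  · obtain ⟨t, ht⟩ := mem (X.presheaf.map (homOfLE l).op v -
      e ^ n * X.presheaf.map (homOfLE l').op v') (by
        rw [map_sub, map_mul, map_pow, app_res_eq, app_res_eq]
        erw [hv, hv', hτ]
        exact sub_self _)
    have h := congrArg (fn hyW) ht
    rw [map_mul, map_sub, map_mul, map_pow, fn_res, fn_res, fn_res] at h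
    have : (fn hU v * fn hU f ^ (n : ℤ) - fn hV v' * fn hV g ^ (n : ℤ)) *
        fn hU f ^ (-(n : ℤ) - 1) = fn hyW t := by
      rw [hE, zpow_sub₀ hF, zpow_neg, zpow_natCast, zpow_natCast, zpow_one]
      field_simp
      linear_combination fn hU f ^ n * h
    rw [this]
    exact fn_mem _ _
  -- For the inverses the factor is `e' ^ n`: on `D`, `w` and `w'` invert functions that differ by
  -- `e ^ n`.
  · obtain ⟨t, ht⟩ := mem (X.presheaf.map (homOfLE l).op w -
      e' ^ n * X.presheaf.map (homOfLE l').op w') (by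
        have hē : D.incl.app W e * D.incl.app W e' = 1 := by
          rw [← map_mul, hee, map_one]
        have a₁ := congrArg (D.toScheme.presheaf.map (homOfLE (D.incl.preimage_mono l)).op) hw
        have a₂ := congrArg (D.toScheme.presheaf.map (homOfLE (D.incl.preimage_mono l')).op) hw'
        rw [map_mul, map_one] at a₁ a₂
        rw [hτ] at a₁
        rw [map_sub, map_mul, map_pow, app_res_eq, app_res_eq]
        generalize D.incl.app W e = ε at *
        generalize D.incl.app W e' = ε' at *
        generalize D.toScheme.presheaf.map (homOfLE (D.incl.preimage_mono l')).op
          (D.trivFn α hg hx') = b at *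
        generalize D.toScheme.presheaf.map (homOfLE (D.incl.preimage_mono l)).op
          (D.incl.app U w) = A at *
        generalize D.toScheme.presheaf.map (homOfLE (D.incl.preimage_mono l')).op
          (D.incl.app V w') = B at *
        have hp : ε ^ n * ε' ^ n = 1 := by rw [← mul_pow, hē, one_pow]
        linear_combination (-A) * hp + (-A * ε ^ n * ε' ^ n) * a₂ + (ε' ^ n * B) * a₁)
    have h := congrArg (fn hyW) ht
    rw [map_mul, map_sub, map_mul, map_pow, fn_res, fn_res, fn_res] at h
    have : (fn hU w * fn hU f ^ (-(n : ℤ)) - fn hV w' * fn hV g ^ (-(n : ℤ))) *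
        fn hU f ^ ((n : ℤ) - 1) = fn hyW t := by
      have : fn hyW e ≠ 0 := left_ne_zero_of_mul_eq_one hE'
      rw [eq_inv_of_mul_eq_one_right hE', inv_pow] at h
      rw [hE, zpow_sub₀ hF, zpow_neg, zpow_neg, zpow_natCast, zpow_natCast, zpow_one]
      field_simp
      field_simp at h
      linear_combination fn hU f ^ n * h
    rw [this]
    exact fn_mem _ _

end

/-- A trivialization of `𝒪_X(D)|_D^{⊗ n}` gives nowhere vanishing sections of `𝒪_X(-nD)|_D` and of
`𝒪_X(nD)|_D`, lifted locally to `X`. -/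
lemma exists_local_lifts {n : ℕ}
    (α : tensorPow ((Scheme.Modules.pullback D.incl).obj (D.sheaf 1)) n ≅
      structureModule D.toScheme) :
    ∃ (U : X → X.affineOpens) (hU : ∀ x, x ∈ (U x).1) (f v w : ∀ x, Γ(X, (U x).1)),
      (∀ x, D.ideal.ideal (U x) = Ideal.span {f x}) ∧
      (∀ x, v x * w x - 1 ∈ D.ideal.ideal (U x)) ∧
      ∀ (x y : X) (hy : y ∈ (U x).1),
        fn (hU y) (v y) * fn (hU y) (f y) ^ (n : ℤ) - fn hy (v x) * fn hy (f x) ^ (n : ℤ) ∈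
          D.fractions (-(n : ℤ) - 1) y ∧
        fn (hU y) (w y) * fn (hU y) (f y) ^ (-(n : ℤ)) -
          fn hy (w x) * fn hy (f x) ^ (-(n : ℤ)) ∈ D.fractions ((n : ℤ) - 1) y := by
  choose U hU f hf _ using D.exists_equation
  have hv : ∀ x, ∃ v, D.incl.app (U x) v = D.trivFn α (hf x) (hU x) := fun x =>
    D.ideal.subschemeι_app_surjective (U x) _
  choose v hv using hv
  have hw : ∀ x, ∃ w, D.incl.app (U x) w * D.trivFn α (hf x) (hU x) = 1 := fun x => by
    obtain ⟨t, ht⟩ := (D.isUnit_trivFn α (hf x) (hU x)).exists_left_inv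
    obtain ⟨w, hw⟩ := D.ideal.subschemeι_app_surjective (U x) t
    exact ⟨w, by rw [← ht, ← hw]⟩
  choose w hw using hw
  refine ⟨U, hU, f, v, w, hf, fun x => ?_, fun x y hy =>
    D.trivFn_lift_sub_mem α (hf y) (hf x) (hU y) (hU x) (hv y) (hv x) (hw y) (hw x) (hU y) hy⟩
  rw [← D.ideal.ker_subschemeι_app]
  change D.incl.app (U x) (v x * w x - 1) = 0
  rw [map_sub, map_mul, map_one, hv, mul_comm, hw, sub_self]

end EffectiveCartierDivisor

/-! ### Function fields and proper surjective morphisms -/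

section FunctionField

variable {X Y : Scheme.{u}} [IsIntegral X] [IsIntegral Y]

/-- A rational function that is regular at all points of `V` is a section over `V`. -/
lemma exists_section_of_forall_mem {V : X.Opens} {c : X.functionField}
    (hc : ∀ y ∈ V, c ∈ localRing y) : ∃ r : Γ(X, V), ∀ y (hy : y ∈ V), fn hy r = c := by
  have h : ∀ y : V, ∃ (W : X.Opens) (_ : W ≤ V) (hy : y.1 ∈ W) (r : Γ(X, W)), fn hy r = c := by
    intro y
    obtain ⟨W, hW, r, hr⟩ := exists_fn_eq (hc y y.2)
    exact ⟨W ⊓ V, inf_le_right, ⟨hW, y.2⟩, X.presheaf.map (homOfLE inf_le_left).op r,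
      (fn_res inf_le_left (show y.1 ∈ W ⊓ V from ⟨hW, y.2⟩) r).trans hr⟩
  choose W hWV hyW r hr using h
  have hcompat : TopCat.Presheaf.IsCompatible X.sheaf.1 W r := by
    intro i j
    obtain ⟨z, hz, hz'⟩ := nonempty_preirreducible_inter (W i).isOpen (W j).isOpen
      ⟨i.1, hyW i⟩ ⟨j.1, hyW j⟩
    -- Two local sections agree on an overlap as soon as they give the same rational function at one
    -- of its points.
    apply fn_injective (U := W i ⊓ W j) (x := z) ⟨hz, hz'⟩
    exact (fn_res inf_le_left _ (r i)).trans (((fn_eq _ (hyW i) _).trans ((hr i).trans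
      ((hr j).symm.trans (fn_eq (hyW j) _ _)))).trans (fn_res inf_le_right _ (r j)).symm)
  obtain ⟨s, hs, -⟩ := X.sheaf.existsUnique_gluing' W V (fun i => homOfLE (hWV i))
    (fun y hy => Opens.mem_iSup.2 ⟨⟨y, hy⟩, hyW ⟨y, hy⟩⟩) r hcompat
  refine ⟨s, fun y hy => ?_⟩
  rw [← hr ⟨y, hy⟩, ← hs ⟨y, hy⟩]
  exact (fn_res (hWV ⟨y, hy⟩) (hyW ⟨y, hy⟩) s).symm

lemma mem_localRing_of_fn {V : X.Opens} {c : X.functionField} {y : X} (hy : y ∈ V) {r : Γ(X, V)}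
    (hr : fn hy r = c) : c ∈ localRing y :=
  hr ▸ fn_mem hy r

/-- The local ring at `x` is local. -/
lemma inv_one_add_mul_mem {x : X} {F s : X.functionField} (hF : F ∈ localRing x)
    (hF' : F⁻¹ ∉ localRing x) (hs : s ∈ localRing x) :
    1 + F * s ≠ 0 ∧ (1 + F * s)⁻¹ ∈ localRing x := by
  obtain ⟨F, rfl⟩ := hF
  obtain ⟨s, rfl⟩ := hs
  have hFm : ¬ IsUnit F := fun h => hF' (by
    obtain ⟨t, ht⟩ := h.exists_right_inv
    refine ⟨t, eq_inv_of_mul_eq_one_right ?_⟩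
    rw [← map_mul, ht, map_one])
  have hu : IsUnit (1 + F * s) := by
    by_contra h
    have h1 : F * s ∈ IsLocalRing.maximalIdeal (X.presheaf.stalk x) :=
      Ideal.mul_mem_right _ _ hFm
    have h2 : (1 + F * s) - F * s ∈ IsLocalRing.maximalIdeal (X.presheaf.stalk x) :=
      sub_mem h h1
    rw [add_sub_cancel_right] at h2
    exact h2 isUnit_one
  obtain ⟨t, ht⟩ := hu.exists_right_inv
  have h := congrArg (algebraMap (X.presheaf.stalk x) X.functionField) ht
  rw [map_mul, map_add, map_mul, map_one] at h
  exact ⟨left_ne_zero_of_mul_eq_one h, t, eq_inv_of_mul_eq_one_right h⟩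

variable (π : Y ⟶ X) [Surjective π]

/-- Surjectivity makes the image of the generic point dense, hence generic. Stating a specialization
gives a map of stalks without transport along an equality of points. -/
lemma genericPoint_specializes : π (genericPoint Y) ⤳ genericPoint X := by
  have h : IsGenericPoint (π (genericPoint Y)) Set.univ := by
    have := (genericPoint_spec Y).image π.continuous
    rwa [Set.image_univ, π.surjective.range_eq, closure_univ] at this
  exact h.specializes trivial

/-- The map of function fields induced by a surjective morphism. -/
def funMap : X.functionField →+* Y.functionField :=
  (X.presheaf.stalkSpecializes (genericPoint_specializes π) ≫
    π.stalkMap (genericPoint Y)).hom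

lemma funMap_algebraMap (y : Y) (r : X.presheaf.stalk (π y)) :
    funMap π (algebraMap _ X.functionField r) =
      algebraMap _ Y.functionField (π.stalkMap y r) := by
  have h : genericPoint Y ⤳ y := (genericPoint_spec Y).specializes trivial
  have h' : genericPoint X ⤳ π y := (genericPoint_spec X).specializes trivial
  have e : X.presheaf.stalkSpecializes h' ≫
      X.presheaf.stalkSpecializes (genericPoint_specializes π) ≫ π.stalkMap (genericPoint Y) =
      π.stalkMap y ≫ Y.presheaf.stalkSpecializes h := by
    rw [TopCat.Presheaf.stalkSpecializes_comp_assoc]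
    exact Scheme.Hom.stalkSpecializes_stalkMap π _ _ h
  exact congrArg (fun m => CommRingCat.Hom.hom m r) e

lemma funMap_fn {U : X.Opens} {y : Y} (hy : π y ∈ U) (r : Γ(X, U)) :
    funMap π (fn hy r) = fn (show y ∈ π ⁻¹ᵁ U from hy) (π.app U r) :=
  (funMap_algebraMap π y _).trans (congrArg (algebraMap (Y.presheaf.stalk y) Y.functionField)
    (π.germ_stalkMap_apply U y hy r))

lemma funMap_mem {y : Y} {c : X.functionField} (hc : c ∈ localRing (π y)) :
    funMap π c ∈ localRing y := by
  obtain ⟨r, rfl⟩ := hc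
  exact ⟨_, (funMap_algebraMap π y r).symm⟩

/-- Stalk maps of a morphism of schemes are local homomorphisms, so units are reflected. -/
lemma inv_mem_of_funMap_inv_mem {y : Y} {c : X.functionField} (hc : c ∈ localRing (π y))
    (h : (funMap π c)⁻¹ ∈ localRing y) : c⁻¹ ∈ localRing (π y) := by
  rcases eq_or_ne c 0 with rfl | h0
  · rw [inv_zero]; exact zero_mem _
  obtain ⟨r, rfl⟩ := hc
  obtain ⟨t, ht⟩ := h
  have hu : IsUnit (π.stalkMap y r) := by
    refine IsUnit.of_mul_eq_one t ?_
    apply algebraMap_stalk_injective y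
    rw [map_mul, ht, ← funMap_algebraMap, map_one, mul_inv_cancel₀]
    exact (map_ne_zero _).2 h0
  obtain ⟨q, hq⟩ := (isUnit_of_map_unit (π.stalkMap y).hom r hu).exists_right_inv
  refine ⟨q, eq_inv_of_mul_eq_one_right ?_⟩
  rw [← map_mul, hq, map_one]

end FunctionField

/-! ### Integrality of functions over affine open sets -/

lemma isIntegral_app_congr {X Y : Scheme.{u}} (π : Y ⟶ X) {U V : X.Opens} (h : U = V)
    (hU : (π.app U).hom.IsIntegral) : (π.app V).hom.IsIntegral := by
  subst h; exact hU

lemma isIntegral_app_of_universallyClosed {X Y : Scheme.{u}} (π : Y ⟶ X) [UniversallyClosed π]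
    {U : X.Opens} (hU : IsAffineOpen U) : (π.app U).hom.IsIntegral := by
  have : IsAffine U := hU
  have h := isIntegral_appTop_of_universallyClosed (π ∣_ U)
  rw [morphismRestrict_appTop] at h
  refine isIntegral_app_congr π U.ι_image_top ?_
  have h' : ((π.app (U.ι ''ᵁ ⊤) ≫ Y.presheaf.map (eqToHom
      (image_morphismRestrict_preimage π U ⊤)).op) ≫ inv (Y.presheaf.map (eqToHom
      (image_morphismRestrict_preimage π U ⊤)).op)).hom.IsIntegral :=
    RingHom.isIntegral_respectsIso.1 _ (asIso (Y.presheaf.map (eqToHom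
      (image_morphismRestrict_preimage π U ⊤)).op)).symm.commRingCatIsoToRingEquiv h
  rwa [Category.assoc, IsIso.hom_inv_id, Category.comp_id] at h'

/-! ### Integrality and norms -/

section Norm

variable {K L : Type*} [Field K] [Field L] [Algebra K L]

/-- The norm of `g` from `K(g)` to `K`, together with the degree `d` of `g`: for every `c` in `K`,
the norm of `c g` is `N c ^ d`, which lies in each integrally closed `R` over which `c g` is
integral. -/
lemma exists_norm {g : L} (hg : _root_.IsIntegral K g) : ∃ (d : ℕ) (N : K), 0 < d ∧
    (g ≠ 0 → N ≠ 0) ∧ ∀ (c : K) (R : Type u) [CommRing R] [IsDomain R] [IsIntegrallyClosed R]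
      [Algebra R K] [IsFractionRing R K],
      (((algebraMap K L).comp (algebraMap R K)).IsIntegralElem (g * algebraMap K L c) →
        N * c ^ d ∈ (algebraMap R K).range) ∧
      (((algebraMap K L).comp (algebraMap R K)).IsIntegralElem (g * algebraMap K L c)⁻¹ →
        (N * c ^ d)⁻¹ ∈ (algebraMap R K).range) := by
  -- The norm is taken from `K(g)`, which is finite over `K` because `g` is algebraic. `d` and `N`
  -- are fixed before `R` varies, so one `N` serves all local rings.
  let E := IntermediateField.adjoin K {g}
  have : FiniteDimensional K E := IntermediateField.adjoin.finiteDimensional hg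
  let e : E := ⟨g, IntermediateField.mem_adjoin_simple_self K g⟩
  refine ⟨Module.finrank K E, Algebra.norm K e, Module.finrank_pos, fun h => ?_, ?_⟩
  · exact Algebra.norm_ne_zero_iff.2 fun h0 => h (congrArg Subtype.val h0)
  intro c R _ _ _ _ _
  have hc : Algebra.norm K (e * algebraMap K E c) = Algebra.norm K e * c ^ Module.finrank K E := by
    rw [map_mul, Algebra.norm_algebraMap]
  have key : ∀ z : E, ((algebraMap K L).comp (algebraMap R K)).IsIntegralElem (z : L) →
      Algebra.norm K z ∈ (algebraMap R K).range := by
    intro z hz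
    let : Algebra R E := ((algebraMap K E).comp (algebraMap R K)).toAlgebra
    have : IsScalarTower R K E := IsScalarTower.of_algebraMap_eq fun _ => rfl
    have hz' : _root_.IsIntegral R z := by
      obtain ⟨p, hp, h⟩ := hz
      refine ⟨p, hp, (algebraMap E L).injective ?_⟩
      rw [Polynomial.hom_eval₂, map_zero]
      exact h
    exact IsIntegrallyClosed.isIntegral_iff.1 (Algebra.isIntegral_norm K hz')
  rw [← hc, ← Algebra.norm_inv]
  exact ⟨key (e * algebraMap K E c), key (e * algebraMap K E c)⁻¹⟩

end Norm

section Fibers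

variable {X Y : Scheme.{u}} [IsIntegral X] [IsIntegral Y]

lemma isOpen_setOf_mem_localRing (c : X.functionField) : IsOpen {x : X | c ∈ localRing x} := by
  refine isOpen_iff_forall_mem_open.2 fun x hx => ?_
  obtain ⟨U, hxU, r, hr⟩ := exists_fn_eq hx
  exact ⟨U, fun z hz => mem_localRing_of_fn hz ((fn_eq hz hxU r).trans hr), U.isOpen, hxU⟩

/-- A rational function that is regular along the fibre over `x` is integral over the local ring
at `x`. -/
lemma isIntegralElem_of_fiber (π : Y ⟶ X) [Surjective π] [UniversallyClosed π] {x : X}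
    {c : Y.functionField} (hc : ∀ y, π y = x → c ∈ localRing y) :
    ((funMap π).comp (algebraMap (X.presheaf.stalk x) X.functionField)).IsIntegralElem c := by
  -- As `π` is closed, the points below the non-regular locus of `c` form a closed set. It misses
  -- `x`, so `c` is regular over a whole affine neighbourhood of `x`.
  have hC : IsClosed (π '' {y | c ∈ localRing y}ᶜ) :=
    π.isClosedMap _ (isOpen_setOf_mem_localRing c).isClosed_compl
  have hx : x ∈ (π '' {y | c ∈ localRing y}ᶜ)ᶜ := by
    rintro ⟨y, hy, rfl⟩
    exact hy (hc y rfl)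
  obtain ⟨_, ⟨U, hU, rfl⟩, hxU, hUC⟩ :=
    X.isBasis_affineOpens.exists_subset_of_mem_open hx hC.isOpen_compl
  have hreg : ∀ y ∈ π ⁻¹ᵁ U, c ∈ localRing y := fun y hy => by
    by_contra h
    exact hUC hy ⟨y, h, rfl⟩
  obtain ⟨r, hr⟩ := exists_section_of_forall_mem hreg
  obtain ⟨y, rfl⟩ := π.surjective x
  obtain ⟨q, hq, h⟩ := isIntegral_app_of_universallyClosed π hU r
  refine ⟨q.map (X.presheaf.germ U _ hxU).hom, hq.map _, ?_⟩
  have e : ((funMap π).comp (algebraMap (X.presheaf.stalk (π y)) X.functionField)).comp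
      (X.presheaf.germ U _ hxU).hom = (fn (show y ∈ π ⁻¹ᵁ U from hxU)).comp (π.app U).hom :=
    RingHom.ext fun t => funMap_fn π hxU t
  rw [Polynomial.eval₂_map, e, ← hr y hxU, ← Polynomial.hom_eval₂, h, map_zero]

end Fibers

/-! ### Projective varieties -/

/-- `Proj` of a finite type graded algebra is proper over the spectrum of its degree 0 part, and
here that part consists of the constants. -/
lemma IsProjective.universallyClosed {k : Type u} [Field k] {X : Scheme.{u}}
    {s : X ⟶ Spec (CommRingCat.of k)} (h : IsProjective s) : UniversallyClosed s := by
  obtain ⟨n, i, hi, rfl⟩ := h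
  let := MvPolynomial.gradedAlgebra (σ := Fin (n + 1)) (R := k)
  have h1 : Function.Surjective (algebraMap k
      (MvPolynomial.homogeneousSubmodule (Fin (n + 1)) k 0)) := by
    rintro ⟨q, hq⟩
    rw [MvPolynomial.homogeneousSubmodule_zero] at hq
    obtain ⟨c, hc⟩ := hq
    exact ⟨c, Subtype.ext ((Algebra.algebraMap_eq_smul_one c).trans hc)⟩
  have h2 : Algebra.FiniteType (MvPolynomial.homogeneousSubmodule (Fin (n + 1)) k 0)
      (MvPolynomial (Fin (n + 1)) k) :=
    have : IsScalarTower k (MvPolynomial.homogeneousSubmodule (Fin (n + 1)) k 0)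
      (MvPolynomial (Fin (n + 1)) k) := ⟨fun c a b => smul_mul_assoc c a.1 b⟩
    Algebra.FiniteType.of_restrictScalars_finiteType k _ _
  have h3 : IsClosedImmersion (Spec.map (CommRingCat.ofHom (algebraMap k
      (MvPolynomial.homogeneousSubmodule (Fin (n + 1)) k 0)))) :=
    IsClosedImmersion.spec_of_surjective _ h1
  have h4 : UniversallyClosed (projectiveSpaceToSpec k n) := by
    have h5 : UniversallyClosed
      (Proj.toSpecZero (MvPolynomial.homogeneousSubmodule (Fin (n + 1)) k)) := inferInstance
    exact MorphismProperty.comp_mem _ _ _ h5 inferInstance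
  infer_instance

/-! ### Poles along $D$, and $\mathcal O_X(aD)$ pulled back to $Y$ -/

namespace EffectiveCartierDivisor

variable {X Y : Scheme.{u}} [IsIntegral X] [IsIntegral Y] (D : EffectiveCartierDivisor X)

/-- Local equations of `D` are not units along `D`. -/
lemma inv_notMem_localRing {U : X.affineOpens} {f : Γ(X, U)}
    (hf : D.ideal.ideal U = Ideal.span {f}) {d : D.toScheme} (hd : D.incl d ∈ U.1) :
    (fn hd f)⁻¹ ∉ localRing (D.incl d) := by
  rintro ⟨t, ht⟩
  have hu : IsUnit (X.presheaf.germ U.1 (D.incl d) hd f) := by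
    refine IsUnit.of_mul_eq_one t (algebraMap_stalk_injective _ ?_)
    rw [map_mul, ht, map_one]
    exact mul_inv_cancel₀ (D.fn_ne_zero hf hd)
  have hs : D.incl d ∈ D.ideal.support := by
    have : D.incl d ∈ Set.range D.incl := ⟨d, rfl⟩
    rwa [D.ideal.range_subschemeι] at this
  rw [D.ideal.mem_support_iff_of_mem hd] at hs
  exact (X.mem_zeroLocus_iff _ _).1 hs f (hf ▸ Ideal.mem_span_singleton_self f)
    ((X.mem_basicOpen _ _ hd).2 hu)

/-- The only rational functions with poles bounded by `m D` are the constants. -/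
lemma mem_localRing_of_h0_eq_one {k : Type u} [Field k] {s : X ⟶ Spec (CommRingCat.of k)} {m : ℕ}
    (h : h0 s (D.sheaf m) = 1) {N : X.functionField} (hN : ∀ x, N ∈ D.fractions m x) (x : X) :
    N ∈ localRing x := by
  let := Module.compHom Γ(D.sheaf m, ⊤)
    ((Scheme.ΓSpecIso (CommRingCat.of k)).inv ≫ s.appTop).hom
  have h1 : ∀ x, (1 : X.functionField) ∈ D.fractions m x := by
    intro x U hx f _
    rw [one_mul, zpow_natCast]
    exact pow_mem (fn_mem hx f) m
  let σ : Γ(D.sheaf m, ⊤) := show D.sections m ⊤ from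
    ⟨fun _ => 1, IsLocallyConstant.const _, fun x => h1 x⟩
  let τ : Γ(D.sheaf m, ⊤) := show D.sections m ⊤ from
    ⟨fun _ => N, IsLocallyConstant.const _, fun x => hN x⟩
  have hσ : σ ≠ 0 := fun h0 => by
    have := congrFun (congrArg Subtype.val (show (show D.sections m ⊤ from σ) = 0 from h0))
      ⟨x, trivial⟩
    exact one_ne_zero this
  -- The constant function 1 is a non-zero section, so it spans, and `N` is a scalar from `k`.
  obtain ⟨c, hc⟩ := (finrank_eq_one_iff_of_nonzero' σ hσ).1 h τ
  have := congrFun (congrArg Subtype.val (show (show D.sections m ⊤ from c • σ) = τ from hc))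
    ⟨x, trivial⟩
  have e : fn (show x ∈ (⊤ : X.Opens) from trivial)
    (((Scheme.ΓSpecIso (CommRingCat.of k)).inv ≫ s.appTop).hom c) * 1 = N := this
  rw [← e, mul_one]
  exact fn_mem _ _

variable (π : Y ⟶ X) [Surjective π]

/-- The stalk at `y` of the pullback of `𝒪_X(aD)`, inside the function field of `Y`. -/
def pullFractions (a : ℤ) (y : Y) : Submodule (Y.presheaf.stalk y) Y.functionField where
  carrier := { c | ∀ (U : X.affineOpens) (hx : π y ∈ U.1) (f : Γ(X, U)),
    D.ideal.ideal U = Ideal.span {f} → c * funMap π (fn hx f) ^ a ∈ localRing y }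
  zero_mem' U hx f _ := by rw [zero_mul]; exact zero_mem _
  add_mem' h₁ h₂ U hx f hf := by
    rw [add_mul]; exact add_mem (h₁ U hx f hf) (h₂ U hx f hf)
  smul_mem' r c h U hx f hf := by
    rw [Algebra.smul_def, mul_assoc]; exact mul_mem ⟨r, rfl⟩ (h U hx f hf)

lemma funMap_mem_pullFractions {a : ℤ} {y : Y} {c : X.functionField}
    (hc : c ∈ D.fractions a (π y)) : funMap π c ∈ D.pullFractions π a y := by
  intro U hx f hf
  rw [← map_zpow₀, ← map_mul]
  exact funMap_mem π (hc U hx f hf)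

/-- If pullback kills `H¹(X, 𝒪_X(aD))`, then the pullback of a `1`-cocycle that is a difference of
rational functions `b` can be solved on `Y`. -/
lemma exists_rational {a : ℤ} (h : cohPullback π (D.sheaf a) 1 = 0) {U : X → X.affineOpens}
    (hU : ∀ x, x ∈ (U x).1) {b : X → X.functionField}
    (hb : ∀ x y, y ∈ (U x).1 → b y - b x ∈ D.fractions a y) :
    ∃ g, ∀ y, g - funMap π (b (π y)) ∈ D.pullFractions π a y := by
  rw [sheaf_eq_ratSheaf] at h
  exact exists_rational_of_cohPullback_eq_zero π (funMap π) (funMap_algebraMap π)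
    (fun y c hc => D.funMap_mem_pullFractions π hc) h b
    (fun x => ⟨(U x).1, hU x, b x, fun z hz => hb x z hz⟩)

end EffectiveCartierDivisor

/-! ### The two classes that survive on $Y$ -/

namespace EffectiveCartierDivisor

variable {X Y : Scheme.{u}} [IsIntegral X] [IsIntegral Y] (D : EffectiveCartierDivisor X)
  (π : Y ⟶ X) [Surjective π]

lemma inv_funMap_notMem_localRing {U : X.affineOpens} {f : Γ(X, U)}
    (hf : D.ideal.ideal U = Ideal.span {f}) {d : D.toScheme} {y : Y} (hy : π y = D.incl d)
    (hyU : π y ∈ U.1) : (funMap π (fn hyU f))⁻¹ ∉ localRing y := by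
  intro hmem
  have hd : D.incl d ∈ U.1 := hy ▸ hyU
  have := inv_mem_of_funMap_inv_mem π (fn_mem _ _) hmem
  rw [fn_eq hyU hd, hy] at this
  exact D.inv_notMem_localRing hf hd this

/-- Over `D`, where the pulled back equation is a non-unit, this makes `v` and `w` units of the
local rings of `Y`. -/
lemma exists_funMap_mul_eq {U : X.affineOpens} {f v w : Γ(X, U)}
    (hf : D.ideal.ideal U = Ideal.span {f}) (hvw : v * w - 1 ∈ D.ideal.ideal U) {y : Y}
    (hy : π y ∈ U.1) : ∃ t ∈ localRing y,
      funMap π (fn hy v) * funMap π (fn hy w) = 1 + funMap π (fn hy f) * t := by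
  rw [hf] at hvw
  obtain ⟨q, hq⟩ := Ideal.mem_span_singleton.1 hvw
  refine ⟨funMap π (fn hy q), funMap_mem π (fn_mem _ _), ?_⟩
  have := congrArg (fun r => funMap π (fn hy r)) hq
  simp only [map_sub, map_mul, map_one] at this
  rw [← this]
  ring

/-- A trivialization of `𝒪_X(nD)` along a nonempty divisor `D` gives a class in
`H¹(X, 𝒪_X(-(n+1)D))` that survives on every `Y` whose global functions form a field. -/
theorem cohPullback_neg_ne_zero [Nonempty D.toScheme] {n : ℕ} (hn : 0 < n)
    (α : tensorPow ((Scheme.Modules.pullback D.incl).obj (D.sheaf 1)) n ≅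
      structureModule D.toScheme) (hY : IsField Γ(Y, ⊤)) :
    cohPullback π (D.sheaf (-(n : ℤ) - 1)) 1 ≠ 0 := by
  intro h
  obtain ⟨U, hU, f, v, w, hf, hvw, hb⟩ := D.exists_local_lifts α
  obtain ⟨g, hg⟩ := D.exists_rational π h hU
    (b := fun x => fn (hU x) (v x) * fn (hU x) (f x) ^ (n : ℤ)) (fun x y hy => by
      rw [fn_eq (hU x) hy, fn_eq (hU x) hy]
      exact (hb x y hy).1)
  -- Membership of `g - b` in the pulled back $\mathcal O_X(-(n+1)D)$, with denominators cleared: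
  -- `g` is $F^n$ times a lift of the trivialization.
  have hg' : ∀ y, ∃ t ∈ localRing y, g = funMap π (fn (hU (π y)) (f (π y))) ^ n *
      (funMap π (fn (hU (π y)) (v (π y))) + funMap π (fn (hU (π y)) (f (π y))) * t) := by
    intro y
    have h0 : funMap π (fn (hU (π y)) (f (π y))) ≠ 0 :=
      (map_ne_zero _).2 (D.fn_ne_zero (hf _) _)
    refine ⟨_, hg y (U (π y)) (hU _) (f (π y)) (hf _), ?_⟩
    rw [map_mul, map_zpow₀, zpow_sub₀ h0, zpow_neg, zpow_natCast, zpow_one]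
    field_simp
    ring
  have hfm : ∀ y, funMap π (fn (hU (π y)) (f (π y))) ∈ localRing y := fun y =>
    funMap_mem π (fn_mem _ _)
  obtain ⟨G, hG⟩ := exists_section_of_forall_mem (V := (⊤ : Y.Opens)) (c := g) fun y _ => by
    obtain ⟨t, ht, e⟩ := hg' y
    rw [e]
    exact mul_mem (pow_mem (hfm y) n)
      (add_mem (funMap_mem π (fn_mem _ _)) (mul_mem (hfm y) ht))
  obtain ⟨d⟩ := ‹Nonempty D.toScheme›
  obtain ⟨y, hy⟩ := π.surjective (D.incl d)
  obtain ⟨t, ht, e⟩ := hg' y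
  have hF0 : funMap π (fn (hU (π y)) (f (π y))) ≠ 0 :=
    (map_ne_zero _).2 (D.fn_ne_zero (hf _) _)
  have hF := D.inv_funMap_notMem_localRing π (hf (π y)) hy (hU _)
  have hFm := hfm y
  obtain ⟨t', ht', e'⟩ := D.exists_funMap_mul_eq π (hf (π y)) (hvw (π y)) (hU _)
  have hvm : funMap π (fn (hU (π y)) (v (π y))) ∈ localRing y := funMap_mem π (fn_mem _ _)
  have hwm : funMap π (fn (hU (π y)) (w (π y))) ∈ localRing y := funMap_mem π (fn_mem _ _)
  generalize funMap π (fn (hU (π y)) (f (π y))) = F at *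
  generalize funMap π (fn (hU (π y)) (v (π y))) = v at *
  generalize funMap π (fn (hU (π y)) (w (π y))) = w at *
  -- If `g = 0`, then `v` lies in the ideal of `F` at `y` although `v * w` is 1 modulo `F`. If not,
  -- `g` is invertible and so is its divisor `F`, which vanishes at `y`.
  rcases eq_or_ne g 0 with rfl | hg0
  · have h1 : v + F * t = 0 := (mul_eq_zero.1 e.symm).resolve_left (pow_ne_zero _ hF0)
    refine (inv_one_add_mul_mem hFm hF (add_mem ht' (mul_mem ht hwm))).1 ?_
    linear_combination w * h1 - e'
  · have hG0 : G ≠ 0 := by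
      rintro rfl
      exact hg0 ((hG y trivial).symm.trans (map_zero _))
    obtain ⟨G', hG'⟩ := hY.mul_inv_cancel hG0
    have h1 : g * fn (show y ∈ (⊤ : Y.Opens) from trivial) G' = 1 := by
      rw [← hG y trivial, ← map_mul, hG', map_one]
    refine hF ?_
    -- Positivity of `n` leaves a factor `F` of `g` to split off.
    obtain ⟨m, rfl⟩ := Nat.exists_eq_succ_of_ne_zero hn.ne'
    have h2 : F⁻¹ = F ^ m * (v + F * t) * fn (show y ∈ (⊤ : Y.Opens) from trivial) G' := by
      refine (eq_inv_of_mul_eq_one_right ?_).symm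
      rw [← h1, e, Nat.succ_eq_add_one]
      ring
    rw [h2]
    exact mul_mem (mul_mem (pow_mem hFm m) (add_mem hvm (mul_mem hFm ht))) (fn_mem _ _)

/-- A trivialization of `𝒪_X(nD)` along a nonempty divisor `D` gives a class in
`H¹(X, 𝒪_X((n-1)D))` that survives on `Y` if there are no functions with poles along `D` only. -/
theorem cohPullback_sub_one_ne_zero [Nonempty D.toScheme] [UniversallyClosed π] {n : ℕ}
    (hn : 0 < n)
    (α : tensorPow ((Scheme.Modules.pullback D.incl).obj (D.sheaf 1)) n ≅
      structureModule D.toScheme) (hX : IsNormal X)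
    (hD : ∀ m : ℕ, 0 < m → ∀ N : X.functionField, (∀ x, N ∈ D.fractions m x) →
      ∀ x, N ∈ localRing x) :
    cohPullback π (D.sheaf ((n : ℤ) - 1)) 1 ≠ 0 := by
  intro h
  obtain ⟨U, hU, f, v, w, hf, hvw, hb⟩ := D.exists_local_lifts α
  obtain ⟨g, hg⟩ := D.exists_rational π h hU
    (b := fun x => fn (hU x) (w x) * fn (hU x) (f x) ^ (-(n : ℤ))) (fun x y hy => by
      rw [fn_eq (hU x) hy, fn_eq (hU x) hy]
      exact (hb x y hy).2)
  have hg' : ∀ y, ∃ t ∈ localRing y, g * funMap π (fn (hU (π y)) (f (π y)) ^ n) =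
      funMap π (fn (hU (π y)) (w (π y))) + funMap π (fn (hU (π y)) (f (π y))) * t := by
    intro y
    have h0 : funMap π (fn (hU (π y)) (f (π y))) ≠ 0 :=
      (map_ne_zero _).2 (D.fn_ne_zero (hf _) _)
    refine ⟨_, hg y (U (π y)) (hU _) (f (π y)) (hf _), ?_⟩
    rw [map_mul, map_zpow₀, map_pow, zpow_sub₀ h0, zpow_neg, zpow_natCast, zpow_one]
    field_simp
    ring
  have hint : ∀ x, ((funMap π).comp (algebraMap (X.presheaf.stalk x)
      X.functionField)).IsIntegralElem (g * funMap π (fn (hU x) (f x) ^ n)) := by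
    refine fun x => isIntegralElem_of_fiber π ?_
    rintro y rfl
    obtain ⟨t, ht, e⟩ := hg' y
    rw [e]
    exact add_mem (funMap_mem π (fn_mem _ _)) (mul_mem (funMap_mem π (fn_mem _ _)) ht)
  obtain ⟨d⟩ := ‹Nonempty D.toScheme›
  -- Over the point of `D`, $gF^n=w+Ft$ and $v(w+Ft)=1+F(t'+vt)$ is a unit of the local ring.
  have hunit : ∀ y, π y = D.incl d → g * funMap π (fn (hU (π y)) (f (π y)) ^ n) ≠ 0 ∧
      (g * funMap π (fn (hU (π y)) (f (π y)) ^ n))⁻¹ ∈ localRing y := by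
    intro y hy
    obtain ⟨t, ht, e⟩ := hg' y
    obtain ⟨t', ht', e'⟩ := D.exists_funMap_mul_eq π (hf (π y)) (hvw (π y)) (hU _)
    have hF := D.inv_funMap_notMem_localRing π (hf (π y)) hy (hU _)
    have hFm : funMap π (fn (hU (π y)) (f (π y))) ∈ localRing y := funMap_mem π (fn_mem _ _)
    have hvm : funMap π (fn (hU (π y)) (v (π y))) ∈ localRing y := funMap_mem π (fn_mem _ _)
    rw [e]
    clear e
    generalize funMap π (fn (hU (π y)) (f (π y))) = F at *
    generalize funMap π (fn (hU (π y)) (v (π y))) = v at *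
    generalize funMap π (fn (hU (π y)) (w (π y))) = w at *
    obtain ⟨h1, h2⟩ := inv_one_add_mul_mem hFm hF (add_mem ht' (mul_mem hvm ht))
    have h3 : v * (w + F * t) = 1 + F * (t' + v * t) := by linear_combination e'
    rw [← h3] at h1 h2
    refine ⟨right_ne_zero_of_mul h1, ?_⟩
    rw [mul_inv] at h2
    have h4 := mul_mem hvm h2
    rwa [mul_inv_cancel_left₀ (left_ne_zero_of_mul h1)] at h4
  have hint' : ((funMap π).comp (algebraMap (X.presheaf.stalk (D.incl d))
      X.functionField)).IsIntegralElem
        (g * funMap π (fn (hU (D.incl d)) (f (D.incl d)) ^ n))⁻¹ := by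
    refine isIntegralElem_of_fiber π fun y hy => ?_
    have := (hunit y hy).2
    rwa [hy] at this
  let := (funMap π).toAlgebra
  have hF0 : fn (hU (D.incl d)) (f (D.incl d)) ≠ 0 := D.fn_ne_zero (hf _) _
  -- $gf^n$ is integral over a local ring of `X`, and $f^n$ is a non-zero element of the function
  -- field, so `g` is algebraic over it.
  have hgint : _root_.IsIntegral X.functionField g := by
    have h1 : _root_.IsIntegral X.functionField
        (g * algebraMap X.functionField Y.functionField
          (fn (hU (D.incl d)) (f (D.incl d)) ^ n)) := by
      obtain ⟨q, hq, h⟩ := hint (D.incl d)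
      exact ⟨q.map (algebraMap _ _), hq.map _, (Polynomial.eval₂_map _ _ _).trans h⟩
    have h2 := h1.mul (isIntegral_algebraMap (x := (fn (hU (D.incl d)) (f (D.incl d)) ^ n)⁻¹))
    rwa [mul_assoc, ← map_mul, mul_inv_cancel₀ (pow_ne_zero _ hF0), map_one, mul_one] at h2
  have hg0 : g ≠ 0 := by
    obtain ⟨y, hy⟩ := π.surjective (D.incl d)
    exact left_ne_zero_of_mul (hunit y hy).1
  obtain ⟨m, N, hm, hN0, hN⟩ := exists_norm hgint
  -- The norm of $gf^n$ is $Nf^{nm}$, so the poles of `N` are bounded by $nmD$.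
  have hNm : ∀ x, N ∈ D.fractions (n * m : ℕ) x := by
    intro x
    have := (hX x).1
    have := (hX x).2
    rw [D.mem_fractions_iff (hf x) (hU x), zpow_natCast, pow_mul]
    exact (hN _ (X.presheaf.stalk x)).1 (hint x)
  have hNr := hD _ (Nat.mul_pos hn hm) N hNm (D.incl d)
  have hNi : (N * (fn (hU (D.incl d)) (f (D.incl d)) ^ n) ^ m)⁻¹ ∈ localRing (D.incl d) := by
    have := (hX (D.incl d)).1
    have := (hX (D.incl d)).2
    exact (hN _ (X.presheaf.stalk (D.incl d))).2 hint'
  refine D.inv_notMem_localRing (hf (D.incl d)) (hU _) ?_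
  have hFm := fn_mem (hU (D.incl d)) (f (D.incl d))
  generalize fn (hU (D.incl d)) (f (D.incl d)) = F at *
  -- With $nm=q+1$, the inverse of `F` is $NF^q$, regular because `N` is, times the regular inverse
  -- of $NF^{q+1}$. This contradicts that `F` vanishes at the point of `D`.
  obtain ⟨q, hq⟩ := Nat.exists_eq_succ_of_ne_zero (Nat.mul_pos hn hm).ne'
  rw [← pow_mul, hq] at hNi
  have h1 := mul_mem (mul_mem hNr (pow_mem hFm q)) hNi
  have h2 : N * F ^ q * (N * F ^ q.succ)⁻¹ = F⁻¹ := by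
    have := hN0 hg0
    field_simp
    rw [pow_succ]
  rwa [h2] at h1

end EffectiveCartierDivisor

end NefLineBundles
end

theorem theorem2p1 {k : Type u} [Field k] [IsAlgClosed k] (p : ℕ) [Fact p.Prime] [CharP k p]
    {X : Scheme.{u}} [AlgebraicGeometry.IsIntegral X] (s : X ⟶ Spec (CommRingCat.of k))
    (hproj : IsProjective s) (hnormal : IsNormal X) (hdim : 2 ≤ topologicalKrullDim X)
    (hH1 : Subsingleton (coh X (structureModule X) 1))
    (D : EffectiveCartierDivisor X) [ConnectedSpace D.toScheme]
    [AlgebraicGeometry.IsReduced D.toScheme]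
    (hD : HasPicOrder ((Scheme.Modules.pullback D.incl).obj (D.sheaf 1)) p)
    (hmD : ∀ m : ℕ, 0 < m → h0 s (D.sheaf m) = 1)
    {Y : Scheme.{u}} [AlgebraicGeometry.IsIntegral Y] (π : Y ⟶ X) [IsProper π]
    [AlgebraicGeometry.Surjective π] (hπ : IsGenericallyFinite π) :
    cohPullback π (D.sheaf (-(p : ℤ) - 1)) 1 ≠ 0 ∧ cohPullback π (D.sheaf ((p : ℤ) - 1)) 1 ≠ 0 := by
  have hp : 0 < p := (Fact.out : p.Prime).pos
  obtain ⟨α⟩ := (hD p).2 (dvd_refl p)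
  have := hproj.universallyClosed
  exact ⟨D.cohPullback_neg_ne_zero π hp α (isField_of_universallyClosed k (π ≫ s)),
    D.cohPullback_sub_one_ne_zero π hp α hnormal fun m hm N hN =>
      D.mem_localRing_of_h0_eq_one (hmD m hm) hN⟩
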